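/- Let $X_i(z), Y_i(z)$ ($1\le i\le N$) be symplectic bosons acting on a complex vector space $V$: fields on $V$ whose OPEs are $X_i(z)Y_j(w)\sim \delta_{ij}/(z-w)$, $X_i(z)X_j(w)\sim 0$, $Y_i(z)Y_j(w)\sim 0$. For (bosonic) fields $A,B$ and $p\in\mathbb{Z}$ put $$(AB)_p(w)=\oint\frac{dz}{2\pi i}(z-w)^{p-1}A(z)B(w)$$ (radially ordered, $z$ encircling $w$), so that $(AB)_0$ is the normally ordered product. Put $\mathcal A_i=-(X_iY_i)_0$, $\mathcal D_i\mathcal O=(\mathcal A_i\mathcal O)_0+(X_i(Y_i\mathcal O)_0)_0$ and $D_i\mathcal O=\mathcal D_i\mathcal O+(\mathcal A_i\mathcal O)_0$. For each $i$ let each of $P_i$ and $Q_i$ be one of $X_i$, $D_iX_i$, and set $$\mathcal P_1=P_1,\quad \mathcal P_{n+1}=(P_{n+1}\mathcal P_n)_0,\qquad \mathcal Q_1=Q_1,\quad \mathcal Q_{n+1}=(Q_{n+1}\mathcal Q_n)_0 .$$ Let $R_{P_i,Q_i}=-(X_iX_i)_0$ if $P_i=X_i$ and $Q_i=D_iX_i$;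 $R_{P_i,Q_i}=(X_iX_i)_0$ if $P_i=D_iX_i$ and $Q_i=X_i$; and $R_{P_i,Q_i}=0$ if $P_i=Q_i$. Then for every integer $n$ with $1\le n$ and $n+1\le N$ and every integer $p$, $$(\mathcal P_{n+1}\mathcal Q_{n+1})_p=\begin{cases}\bigl(R_{P_{n+1},Q_{n+1}}(\mathcal P_n\mathcal Q_n)_{p-1}\bigr)_0+\displaystyle\sum_{q=p}^{n}\bigl(P_{n+1}(Q_{n+1}(\mathcal P_n\mathcal Q_n)_q)_0\bigr)_{p-q} & (p\le n)\\[2mm] \bigl(R_{P_{n+1},Q_{n+1}}(\mathcal P_n\mathcal Q_n)_{p-1}\bigr)_0 & (p=n+1)\\[1mm] 0 & (p\ge n+2).\end{cases}$$ In particular, if $P_{n+1}=Q_{n+1}$, then $(\mathcal P_{n+1}\mathcal Q_{n+1})_p=\sum_{q=p}^{n}\bigl(P_{n+1}(Q_{n+1}(\mathcal P_n\mathcal Q_n)_q)_0\bigr)_{p-q}$ for $p\le n$, and $(\mathcal P_{n+1}\mathcal Q_{n+1})_p=0$ for $p\ge n+1$. -/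

import Mathlib

noncomputable section

namespace SymplecticBoson

open VertexOperator

section Fields

variable {V : Type*} [AddCommGroup V] [Module ℂ V]

/-- Every vector is annihilated by all modes of a field of sufficiently high index. -/
theorem exists_ncoeff_eq_zero (A : VertexOperator ℂ V) (v : V) :
    ∃ M : ℤ, ∀ m : ℤ, M ≤ m → ncoeff A m v = 0 := by
  refine ⟨-(HahnSeries.order ((HahnModule.of ℂ).symm (A v))), fun m hm => ?_⟩
  exact ncoeff_eq_zero_of_lt_order A m v (by omega)

/-- The `j`-th term of the `m`-th mode of the residue product `A_(k) B`, namely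
`(-1)^j * binom k j * (A_(k-j) B_(m+j) - (-1)^k * B_(m+k-j) A_(j))`. -/
def resTerm (k : ℤ) (A B : VertexOperator ℂ V) (m : ℤ) (j : ℕ) : Module.End ℂ V :=
  ((-1 : ℤ) ^ j * Ring.choose k j) •
    (ncoeff A (k - j) * ncoeff B (m + j) -
      (Int.negOnePow k : ℤ) • (ncoeff B (m + k - j) * ncoeff A (j : ℤ)))

theorem resTerm_eventually_zero (k : ℤ) (A B : VertexOperator ℂ V) (m : ℤ) (v : V) :
    ∃ J : ℕ, ∀ j : ℕ, J ≤ j → resTerm k A B m j v = 0 := by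
  obtain ⟨M, hM⟩ := exists_ncoeff_eq_zero A v
  obtain ⟨M', hM'⟩ := exists_ncoeff_eq_zero B v
  refine ⟨M.toNat + (M' - m).toNat, fun j hj => ?_⟩
  have h1 : ncoeff A (j : ℤ) v = 0 := hM _ (by omega)
  have h2 : ncoeff B (m + j) v = 0 := hM' _ (by omega)
  simp [resTerm, h1, h2]

theorem resTerm_support_finite (k : ℤ) (A B : VertexOperator ℂ V) (m : ℤ) (v : V) :
    (Function.support fun j : ℕ => resTerm k A B m j v).Finite := by
  obtain ⟨J, hJ⟩ := resTerm_eventually_zero k A B m v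
  refine (Set.finite_lt_nat J).subset fun j hj => ?_
  by_contra h
  exact hj (hJ j (not_lt.mp h))

/-- The `m`-th mode of the residue product `A_(k) B`. On every vector the sum has only finitely
many nonzero terms. -/
def resMode (k : ℤ) (A B : VertexOperator ℂ V) (m : ℤ) : Module.End ℂ V where
  toFun v := ∑ᶠ j : ℕ, resTerm k A B m j v
  map_add' u v := by
    simp only [map_add]
    exact finsum_add_distrib (resTerm_support_finite k A B m u)
      (resTerm_support_finite k A B m v)
  map_smul' c v := by
    simp only [map_smul, RingHom.id_apply]
    exact (smul_finsum c _).symm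

theorem resMode_truncated (k : ℤ) (A B : VertexOperator ℂ V) (v : V) :
    ∃ M : ℤ, ∀ m : ℤ, M ≤ m → resMode k A B m v = 0 := by
  obtain ⟨MA, hMA⟩ := exists_ncoeff_eq_zero A v
  obtain ⟨MB, hMB⟩ := exists_ncoeff_eq_zero B v
  choose L hL using fun j : ℕ => exists_ncoeff_eq_zero B (ncoeff A (j : ℤ) v)
  obtain ⟨K, hK⟩ : ∃ K : ℤ, ∀ j ∈ Finset.range MA.toNat, L j - k + j ≤ K := by
    obtain ⟨K, hK⟩ := ((Finset.range MA.toNat).image fun j : ℕ => L j - k + j).bddAbove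
    exact ⟨K, fun j hj => hK (Finset.mem_coe.mpr (Finset.mem_image_of_mem _ hj))⟩
  refine ⟨max MB K, fun m hm => ?_⟩
  have hB : MB ≤ m := (le_max_left _ _).trans hm
  have hm' : K ≤ m := (le_max_right _ _).trans hm
  have key : ∀ j : ℕ, resTerm k A B m j v = 0 := by
    intro j
    have h1 : ncoeff B (m + j) v = 0 := hMB _ (by omega)
    have h2 : ncoeff B (m + k - j) (ncoeff A (j : ℤ) v) = 0 := by
      by_cases hj : j < MA.toNat
      · have := hK j (Finset.mem_range.mpr hj)
        exact hL j _ (by omega)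
      · rw [hMA j (by omega), map_zero]
    simp [resTerm, h1, h2]
  change ∑ᶠ j : ℕ, resTerm k A B m j v = 0
  simp [key]

/-- A field with prescribed modes `f m`, i.e. `∑ m, f m * z ^ (-m-1)`. -/
def ofModes (f : ℤ → Module.End ℂ V) (hf : ∀ v, ∃ M : ℤ, ∀ m : ℤ, M ≤ m → f m v = 0) :
    VertexOperator ℂ V :=
  VertexOperator.of_coeff (fun n => f (-n - 1)) fun v => by
    obtain ⟨M, hM⟩ := hf v
    refine ⟨-M, fun n hn => ?_⟩
    by_contra h
    exact hn (hM _ (by omega))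

@[simp]
theorem ncoeff_ofModes (f : ℤ → Module.End ℂ V)
    (hf : ∀ v, ∃ M : ℤ, ∀ m : ℤ, M ≤ m → f m v = 0) (m : ℤ) :
    ncoeff (ofModes f hf) m = f m := by
  simp [ofModes]

/-- The product of fields
`(A B)_p (w) = ∮ dz/(2πi) (z - w)^(p-1) A(z) B(w)`, the integral over a small circle around `w`
being, as usual for radially ordered products, the difference of the integrals over `|z| > |w|`
and `|z| < |w|`:
`Res_z (A(z) B(w) (z-w)^(p-1)|_{|z|>|w|} - B(w) A(z) (z-w)^(p-1)|_{|z|<|w|})`. -/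
def prod (p : ℤ) (A B : VertexOperator ℂ V) : VertexOperator ℂ V :=
  ofModes (resMode (p - 1) A B) (resMode_truncated (p - 1) A B)

/-- The identity field. -/
def idField : VertexOperator ℂ V :=
  ofModes (fun m => if m = -1 then 1 else 0) fun v =>
    ⟨0, fun m hm => by simp [show m ≠ -1 by omega]⟩

/-- The operator product expansion `A(z) B(w) ∼ C(w) / (z - w)`, in terms of modes:
`[A_(m), B_(n)] = C_(m+n)`. For `C = 0` this says that the OPE is regular. -/
def SimplePoleOPE (A B C : VertexOperator ℂ V) : Prop :=
  ∀ m n : ℤ, ncoeff A m * ncoeff B n - ncoeff B n * ncoeff A m = ncoeff C (m + n)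

end Fields

/-- A system of symplectic bosons `(X i, Y i)` acting on `V`: fields whose only nontrivial OPEs are
`X i (z) Y j (w) ∼ δ_ij / (z - w)`. -/
structure SymplecticBosons (ι : Type*) [DecidableEq ι] (V : Type*) [AddCommGroup V]
    [Module ℂ V] where
  X : ι → VertexOperator ℂ V
  Y : ι → VertexOperator ℂ V
  ope_XY : ∀ i j, SimplePoleOPE (X i) (Y j) (if i = j then idField else 0)
  ope_XX : ∀ i j, SimplePoleOPE (X i) (X j) 0
  ope_YY : ∀ i j, SimplePoleOPE (Y i) (Y j) 0

/-- The two choices `X i` and `D i (X i)` for the factors. -/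
inductive Kind
  | plain
  | cov
  deriving DecidableEq

namespace SymplecticBosons

variable {ι : Type*} [DecidableEq ι] {V : Type*} [AddCommGroup V] [Module ℂ V]
  (S : SymplecticBosons ι V)

/-- `𝒜_i = -(X_i Y_i)_0`. -/
def gauge (i : ι) : VertexOperator ℂ V := -prod 0 (S.X i) (S.Y i)

/-- `𝒜̂_i O = (𝒜_i O)_0`. -/
def gaugeHat (i : ι) (O : VertexOperator ℂ V) : VertexOperator ℂ V := prod 0 (S.gauge i) O

/-- `𝒟_i O = (𝒜_i O)_0 + (X_i (Y_i O)_0)_0`. -/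
def partialD (i : ι) (O : VertexOperator ℂ V) : VertexOperator ℂ V :=
  prod 0 (S.gauge i) O + prod 0 (S.X i) (prod 0 (S.Y i) O)

/-- `D_{i,(e)} O = 𝒟_i O + e 𝒜̂_i O`. -/
def covDWith (e : ℂ) (i : ι) (O : VertexOperator ℂ V) : VertexOperator ℂ V :=
  S.partialD i O + e • S.gaugeHat i O

/-- `D_i = D_{i,(1)}`. -/
def covD (i : ι) (O : VertexOperator ℂ V) : VertexOperator ℂ V := S.covDWith 1 i O

/-- The factor of index `i` of the given kind: `X_i` or `D_i X_i`. -/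
def factor (i : ι) : Kind → VertexOperator ℂ V
  | .plain => S.X i
  | .cov => S.covD i (S.X i)

/-- The coefficient `R_{P_i,Q_i}`. -/
def R (i : ι) : Kind → Kind → VertexOperator ℂ V
  | .plain, .cov => -prod 0 (S.X i) (S.X i)
  | .cov, .plain => prod 0 (S.X i) (S.X i)
  | .plain, .plain => 0
  | .cov, .cov => 0

end SymplecticBosons

/-- The nested product `𝒫_n` of `P_1, …, P_N` for `1 ≤ n ≤ N`:
`𝒫_1 = P_1` and `𝒫_{n+1} = (P_{n+1} 𝒫_n)_0`. The factor `P_i` is `P ⟨i - 1, _⟩`.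
(The value at `n = 0` is a convention.) -/
def nested {V : Type*} [AddCommGroup V] [Module ℂ V] {N : ℕ} (P : Fin N → VertexOperator ℂ V) :
    (n : ℕ) → n ≤ N → VertexOperator ℂ V
  | 0, _ => idField
  | 1, h => P ⟨0, h⟩
  | n + 2, h => prod 0 (P ⟨n + 1, h⟩) (nested P (n + 1) (Nat.le_of_succ_le h))

section Fock

variable (ι : Type*)

/-- The Fock space of the symplectic bosons: polynomials in the creation modes
`x_{i,k} = X_{i,(-k-1)}` (first component `true`) and `y_{i,k} = Y_{i,(-k-1)}` (`false`). -/
abbrev Fock : Type _ := MvPolynomial (Bool × ι × ℕ) ℂ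

variable {ι}

/-- Creation modes act by multiplication, annihilation modes as `s` times the derivative with
respect to the conjugate variable. -/
def fockMode (b : Bool) (s : ℂ) (i : ι) (m : ℤ) : Module.End ℂ (Fock ι) :=
  if 0 ≤ m then s • (MvPolynomial.pderiv (!b, i, m.toNat)).toLinearMap
  else LinearMap.mulLeft ℂ (MvPolynomial.X (b, i, (-m - 1).toNat))

theorem fockMode_truncated (b : Bool) (s : ℂ) (i : ι) (v : Fock ι) :
    ∃ M : ℤ, ∀ m : ℤ, M ≤ m → fockMode b s i m v = 0 := by
  classical
  obtain ⟨K, hK⟩ := (v.vars.image fun t => t.2.2).bddAbove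
  refine ⟨K + 1, fun m hm => ?_⟩
  have h0 : 0 ≤ m := by omega
  have : (!b, i, m.toNat) ∉ v.vars := fun h => by
    have := hK (Finset.mem_coe.mpr (Finset.mem_image_of_mem (fun t => t.2.2) h))
    simp only at this
    omega
  simp [fockMode, h0, MvPolynomial.pderiv_eq_zero_of_notMem_vars this]

theorem pderiv_mulLeft_comm (s t : Bool × ι × ℕ) [Decidable (t = s)] (v : Fock ι) :
    MvPolynomial.pderiv s (MvPolynomial.X t * v) -
      MvPolynomial.X t * MvPolynomial.pderiv s v = if t = s then v else 0 := by
  classical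
  rw [Derivation.leibniz, MvPolynomial.pderiv_X]
  by_cases h : t = s
  · subst h; simp
  · simp [h]

theorem pderiv_pderiv_comm (s t : Bool × ι × ℕ) (v : Fock ι) :
    MvPolynomial.pderiv s (MvPolynomial.pderiv t v) =
      MvPolynomial.pderiv t (MvPolynomial.pderiv s v) := by
  classical
  have h : ⁅(MvPolynomial.pderiv s : Derivation ℂ (Fock ι) (Fock ι)),
      (MvPolynomial.pderiv t : Derivation ℂ (Fock ι) (Fock ι))⁆ = 0 := by
    refine MvPolynomial.derivation_ext fun k => ?_
    simp only [Derivation.commutator_apply, MvPolynomial.pderiv_X, Derivation.zero_apply]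
    simp only [Pi.single_apply]
    split_ifs <;> simp
  have := congrArg (fun D => D v) h
  simpa [Derivation.commutator_apply, sub_eq_zero] using this

/-- The commutation relations of the modes on the Fock space. -/
theorem fockMode_comm [DecidableEq ι] (b c : Bool) (s t : ℂ) (i j : ι) (m n : ℤ) :
    fockMode b s i m * fockMode c t j n - fockMode c t j n * fockMode b s i m =
      if (!b) = c ∧ i = j ∧ m + n = -1 then (if 0 ≤ m then s else -t) • 1 else 0 := by
  refine LinearMap.ext fun v => ?_
  by_cases hm : 0 ≤ m <;> by_cases hn : 0 ≤ n
  · have h1 : m + n ≠ -1 := by omega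
    simp [fockMode, hm, hn, h1, pderiv_pderiv_comm (!b, i, m.toNat), smul_smul, mul_comm s t]
  · have h1 : ((c, j, (-n - 1).toNat) = (!b, i, m.toNat)) ↔
        ((!b) = c ∧ i = j ∧ m + n = -1) := by
      simp only [Prod.mk.injEq]
      refine ⟨fun ⟨h, h', h''⟩ => ⟨h.symm, h'.symm, by omega⟩,
        fun ⟨h, h', h''⟩ => ⟨h.symm, h'.symm, by omega⟩⟩
    have := pderiv_mulLeft_comm (!b, i, m.toNat) (c, j, (-n - 1).toNat) v
    simp only [fockMode, hm, hn, if_true, if_false, LinearMap.sub_apply, Module.End.mul_apply,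
      LinearMap.smul_apply, LinearMap.mulLeft_apply, mul_smul_comm, ← smul_sub,
      Derivation.coeFn_coe, this, h1]
    split_ifs <;> simp
  · have h1 : ((b, i, (-m - 1).toNat) = (!c, j, n.toNat)) ↔
        ((!b) = c ∧ i = j ∧ m + n = -1) := by
      simp only [Prod.mk.injEq]
      refine ⟨fun ⟨h, h', h''⟩ => ⟨by simp [h], h', by omega⟩,
        fun ⟨h, h', h''⟩ => ⟨by simp [← h], h', by omega⟩⟩
    have := pderiv_mulLeft_comm (!c, j, n.toNat) (b, i, (-m - 1).toNat) v
    rw [← neg_sub, LinearMap.neg_apply, ← neg_inj, neg_neg]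
    simp only [fockMode, hm, hn, if_true, if_false, LinearMap.sub_apply, Module.End.mul_apply,
      LinearMap.smul_apply, LinearMap.mulLeft_apply, mul_smul_comm, ← smul_sub,
      Derivation.coeFn_coe, this, h1]
    split_ifs <;> simp
  · have h1 : m + n ≠ -1 := by omega
    simp [fockMode, hm, hn, h1, mul_left_comm]

/-- The standard realization of the symplectic bosons on their Fock space. -/
def fockBosons (ι : Type*) [DecidableEq ι] : SymplecticBosons ι (Fock ι) where
  X i := ofModes (fockMode true 1 i) (fockMode_truncated true 1 i)
  Y i := ofModes (fockMode false (-1) i) (fockMode_truncated false (-1) i)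
  ope_XY i j m n := by
    rw [ncoeff_ofModes, ncoeff_ofModes, fockMode_comm]
    by_cases h : i = j <;> by_cases h' : m + n = -1 <;> simp [h, h', idField]
  ope_XX i j m n := by
    rw [ncoeff_ofModes, ncoeff_ofModes, fockMode_comm]
    simp
  ope_YY i j m n := by
    rw [ncoeff_ofModes, ncoeff_ofModes, fockMode_comm]
    simp

end Fock

end SymplecticBoson

end

/-! The product $(AB)_p$ is a residue against the difference of the two expansions of $(z-w)^{p-1}$.
If $(z-w)^J$ kills $[A(z),B(w)]$, then $(z-w)^JA(z)B(w)$ may be taken in either order, and $(AB)_p$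
is its residue against the difference of the two expansions of $(z-w)^{p-1-J}$
(`IsLocal.ncoeff_prod`). That difference is zero for $p>J$; for $p=J-l$ it is a divided derivative
of the delta function (`deltaCoeff_neg`).

For three fields with $A$ and $B$ commuting, everything is read off from the kernel
$(z-w)^J(y-w)^KA(z)B(y)C(w)$, which is independent of the ordering. Its symmetry gives
$(A(BC)_q)_p=(B(AC)_p)_q$ (`prod_left_comm`). Its restriction to $z=y$, with the Vandermonde
identity, gives $((AB)_0C)_{J+K-l}=\sum_{i+j=l}(A(BC)_{K-j})_{J-i}$ (`prod_prod_zero_left`).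

The recursion is the case $A=P_{n+1}$, $B=\mathcal P_n$, $C=(Q_{n+1}\mathcal Q_n)_0$, with $J=1$ and
$K=n$, since fields of different index commute. The term $i=0$ extracts the simple pole of $P_{n+1}$
with $Q_{n+1}$ and gives the $R$ term; in the others $Q_{n+1}$ is moved out past $\mathcal P_n$
(`prod_prod_prod`). Each factor raises the order of locality by one, which carries the induction and
gives the vanishing for $p\ge n+2$.

It remains to find the expansions among $X_i$ and $D_iX_i$ (`hasOPE_factor`), by the Wick formula
`HasOPE.prod_zero`. The delicate one is $D_iX_i$ with itself: its double poles cancel, and a lone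
simple pole is excluded by antisymmetry. -/

noncomputable section

namespace SymplecticBoson

open VertexOperator

/-! ### Coefficients of the two expansions of $(z-w)^k$. -/

/-- The coefficient of `z ^ s * w ^ (k - s)` in `(z - w) ^ k`, expanded for `|z| > |w|`. -/
def outerCoeff (k s : ℤ) : ℤ :=
  if s ≤ k then (-1) ^ (k - s).toNat * Ring.choose k (k - s).toNat else 0

/-- The coefficient of `z ^ s * w ^ (k - s)` in `(z - w) ^ k`, expanded for `|z| < |w|`. -/
def innerCoeff (k s : ℤ) : ℤ :=
  if 0 ≤ s then (-1) ^ s.toNat * Ring.choose k s.toNat * (Int.negOnePow k : ℤ) else 0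

/-- The coefficients of the difference of the two expansions of `(z - w) ^ k`. -/
def deltaCoeff (k s : ℤ) : ℤ := outerCoeff k s - innerCoeff k s

theorem outerCoeff_of_lt {k s : ℤ} (h : k < s) : outerCoeff k s = 0 := if_neg (not_le.mpr h)

theorem innerCoeff_of_neg {k s : ℤ} (h : s < 0) : innerCoeff k s = 0 := if_neg (not_le.mpr h)

/-- Comparison of coefficients in $(z-w)^{k+1}=(z-w)(z-w)^k$; on binomials this is Pascal's rule. -/
theorem outerCoeff_add_one (k s : ℤ) :
    outerCoeff (k + 1) s = outerCoeff k (s - 1) - outerCoeff k s := by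
  rcases lt_trichotomy s (k + 1) with h | h | h
  · obtain ⟨i, hi⟩ := Int.eq_ofNat_of_zero_le (show 0 ≤ k - s by omega)
    have h1 : (k + 1 - s).toNat = i + 1 := by omega
    have h2 : (k - (s - 1)).toNat = i + 1 := by omega
    have h3 : (k - s).toNat = i := by omega
    rw [outerCoeff, outerCoeff, outerCoeff, if_pos (by omega), if_pos (by omega),
      if_pos (by omega), h1, h2, h3, Ring.choose_succ_succ]
    ring
  · subst h
    simp [outerCoeff]
  · rw [outerCoeff_of_lt h, outerCoeff_of_lt (by omega), outerCoeff_of_lt (by omega), sub_zero]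

theorem innerCoeff_add_one (k s : ℤ) :
    innerCoeff (k + 1) s = innerCoeff k (s - 1) - innerCoeff k s := by
  rcases lt_trichotomy s 0 with h | h | h
  · rw [innerCoeff_of_neg h, innerCoeff_of_neg (by omega), innerCoeff_of_neg h, sub_zero]
  · subst h
    simp [innerCoeff, Int.negOnePow_succ]
  · obtain ⟨i, hi⟩ := Int.eq_ofNat_of_zero_le (show 0 ≤ s - 1 by omega)
    have h1 : s.toNat = i + 1 := by omega
    have h2 : (s - 1).toNat = i := by omega
    rw [innerCoeff, innerCoeff, innerCoeff, if_pos (by omega), if_pos (by omega),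
      if_pos (by omega), h1, h2, Ring.choose_succ_succ, Int.negOnePow_succ]
    push_cast
    ring

theorem outerCoeff_zero (s : ℤ) : outerCoeff 0 s = if s = 0 then 1 else 0 := by
  rcases lt_trichotomy s 0 with h | h | h
  · rw [outerCoeff, if_pos h.le, Ring.choose_zero_pos ℤ (by omega), mul_zero, if_neg h.ne]
  · simp [outerCoeff, h]
  · rw [outerCoeff_of_lt h, if_neg h.ne']

theorem innerCoeff_zero (s : ℤ) : innerCoeff 0 s = if s = 0 then 1 else 0 := by
  rcases lt_trichotomy s 0 with h | h | h
  · rw [innerCoeff_of_neg h, if_neg h.ne]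
  · simp [innerCoeff, h]
  · rw [innerCoeff, if_pos h.le, Ring.choose_zero_pos ℤ (by omega), mul_zero, zero_mul,
      if_neg h.ne']

theorem deltaCoeff_add_one (k s : ℤ) :
    deltaCoeff (k + 1) s = deltaCoeff k (s - 1) - deltaCoeff k s := by
  rw [deltaCoeff, deltaCoeff, deltaCoeff, outerCoeff_add_one, innerCoeff_add_one]
  ring

/-- For $k\ge 0$ both expansions are the same polynomial. -/
theorem deltaCoeff_of_nonneg {k : ℤ} (hk : 0 ≤ k) (s : ℤ) : deltaCoeff k s = 0 := by
  induction k, hk using Int.leInduction generalizing s with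
  | base => rw [deltaCoeff, outerCoeff_zero, innerCoeff_zero, sub_self]
  | succ k _ ih => rw [deltaCoeff_add_one, ih, ih, sub_self]

theorem choose_neg_one_eq (i : ℕ) : Ring.choose (-1 : ℤ) i = (-1) ^ i := by
  rw [Ring.choose_neg, add_sub_cancel_left, Ring.choose_natCast, Nat.choose_self]
  simp [Units.smul_def, Int.coe_negOnePow_natCast]

theorem deltaCoeff_neg_one (s : ℤ) : deltaCoeff (-1) s = 1 := by
  have key (i : ℕ) : (-1 : ℤ) ^ i * (-1) ^ i = 1 := by rw [← mul_pow]; simp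
  rcases lt_or_ge s 0 with h | h
  · rw [deltaCoeff, innerCoeff_of_neg h, outerCoeff, if_pos (by omega), choose_neg_one_eq, key,
      sub_zero]
  · rw [deltaCoeff, outerCoeff_of_lt (by omega), innerCoeff, if_pos h, choose_neg_one_eq, key]
    simp

/-- These are the coefficients of $\partial_w^l\delta(z,w)/l!$, where $\delta=\sum_s z^sw^{-1-s}$.
-/
theorem deltaCoeff_neg (l : ℕ) (s : ℤ) : deltaCoeff (-1 - l) s = Ring.choose (-s - 1) l := by
  induction l generalizing s with
  | zero => simp [deltaCoeff_neg_one]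
  | succ l ih =>
    -- Both sides obey the same first-order recursion in `s`, so their difference does not depend on
    -- `s`; it is then enough to evaluate it once.
    have hstep (s : ℤ) : deltaCoeff (-1 - (l + 1 : ℕ)) (s - 1) - Ring.choose (-(s - 1) - 1) (l + 1)
        = deltaCoeff (-1 - (l + 1 : ℕ)) s - Ring.choose (-s - 1) (l + 1) := by
      have h1 := deltaCoeff_add_one (-1 - (l + 1 : ℕ)) s
      rw [show (-1 - ((l + 1 : ℕ) : ℤ) + 1) = -1 - l by push_cast; ring, ih] at h1
      have h2 := Ring.choose_succ_succ (-s - 1) l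
      rw [show -(s - 1) - 1 = -s - 1 + 1 by ring]
      linarith
    -- At `s = -1` neither expansion contributes: the exponent lies above the outer range and below
    -- the inner one.
    have hbase : deltaCoeff (-1 - (l + 1 : ℕ)) (-1) - Ring.choose (-(-1 : ℤ) - 1) (l + 1) = 0 := by
      rw [deltaCoeff, outerCoeff_of_lt (by omega), innerCoeff_of_neg (by omega)]
      simp [Ring.choose_zero_succ]
    refine sub_eq_zero.mp ?_
    induction s using Int.inductionOn' (b := -1) with
    | zero => exact hbase
    | succ s _ h =>
      rw [← hstep, add_sub_cancel_right]
      exact h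
    | pred s _ h => rw [hstep, h]

/-- Vandermonde's identity. It merges kernels in $z-w$ and $y-w$ into one kernel on the diagonal
$z=y$, where modes `s`, `t` contribute to mode `s + t + 1`. -/
theorem sum_antidiagonal_deltaCoeff (l : ℕ) (s t : ℤ) :
    ∑ x ∈ Finset.HasAntidiagonal.antidiagonal l, deltaCoeff (-1 - x.1) s * deltaCoeff (-1 - x.2) t =
      deltaCoeff (-1 - l) (s + t + 1) := by
  simp only [deltaCoeff_neg]
  rw [show -(s + t + 1) - 1 = (-s - 1) + (-t - 1) by ring,
    Ring.add_choose_eq l (Commute.all (-s - 1) (-t - 1))]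

theorem hasFiniteSupport_of_bounds {M : Type*} [Zero M] {f : ℤ → M} (a b : ℤ)
    (h : ∀ s, s < a ∨ b < s → f s = 0) : Function.HasFiniteSupport f := by
  refine (Set.finite_Icc a b).subset fun s hs => ?_
  by_contra h'
  refine hs (h s ?_)
  rw [Set.mem_Icc] at h'
  omega

/-! ### Multiplication by $z-w$ on distributions in two variables. -/

section Difference

variable {M M' : Type*} [AddCommGroup M] [AddCommGroup M']

/-- Multiplication by `z - w` in terms of the modes of a formal distribution in `z` and `w`. -/
def diff (f : ℤ → ℤ → M) (m n : ℤ) : M := f (m + 1) n - f m (n + 1)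

theorem iterate_diff_sub (J : ℕ) (f g : ℤ → ℤ → M) :
    diff^[J] (f - g) = diff^[J] f - diff^[J] g := by
  induction J generalizing f g with
  | zero => rfl
  | succ J ih =>
    rw [Function.iterate_succ_apply, Function.iterate_succ_apply, Function.iterate_succ_apply, ← ih]
    congr 1
    ext m n
    simp only [diff, Pi.sub_apply]
    abel

theorem iterate_diff_map (φ : M →+ M') (J : ℕ) (f : ℤ → ℤ → M) (m n : ℤ) :
    diff^[J] (fun m n => φ (f m n)) m n = φ (diff^[J] f m n) := by
  induction J generalizing f with
  | zero => rfl
  | succ J ih =>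
    rw [Function.iterate_succ_apply, Function.iterate_succ_apply, ← ih]
    have h : diff (fun m n => φ (f m n)) = fun m n => φ (diff f m n) := by
      ext m n
      simp [diff]
    rw [h]

theorem iterate_diff_left_eq_zero (J : ℕ) {f : ℤ → ℤ → M} {B : ℤ}
    (hf : ∀ m, B ≤ m → ∀ n, f m n = 0) : ∀ m, B ≤ m → ∀ n, diff^[J] f m n = 0 := by
  induction J generalizing f with
  | zero => exact hf
  | succ J ih =>
    rw [Function.iterate_succ_apply]
    refine ih fun m hm n => ?_
    rw [diff, hf _ (by omega), hf _ hm, sub_zero]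

theorem iterate_diff_right_eq_zero (J : ℕ) {f : ℤ → ℤ → M} {B : ℤ}
    (hf : ∀ m n, B ≤ n → f m n = 0) : ∀ m n, B ≤ n → diff^[J] f m n = 0 := by
  induction J generalizing f with
  | zero => exact hf
  | succ J ih =>
    rw [Function.iterate_succ_apply]
    refine ih fun m n hn => ?_
    rw [diff, hf _ _ hn, hf _ _ (by omega), sub_zero]

theorem iterate_diff_finsum {ι : Type*} (J : ℕ) (e : ι → ℤ) (u : ι → ℤ) (f : ι → ℤ → ℤ → M)
    (hf : ∀ m n, Function.HasFiniteSupport fun i => e i • f i m (n + u i)) (m n : ℤ) :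
    diff^[J] (fun m n => ∑ᶠ i, e i • f i m (n + u i)) m n =
      ∑ᶠ i, e i • diff^[J] (f i) m (n + u i) := by
  induction J generalizing f with
  | zero => rfl
  | succ J ih =>
    have key (m n : ℤ) (i : ι) : e i • diff (f i) m (n + u i) =
        e i • f i (m + 1) (n + u i) - e i • f i m ((n + 1) + u i) := by
      rw [diff, smul_sub, add_right_comm]
    simp only [Function.iterate_succ_apply]
    rw [← ih]
    · have h : diff (fun m n => ∑ᶠ i, e i • f i m (n + u i)) =
          fun m n => ∑ᶠ i, e i • diff (f i) m (n + u i) := by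
        ext m n
        simp only [key]
        rw [finsum_sub_distrib (hf _ _) (hf _ _)]
        rfl
      rw [h]
    · intro m n
      simp only [key]
      exact (hf _ _).sub (hf _ _)

end Difference

/-! ### Residues against an expansion of $(z-w)^k$. -/

section Residue

variable {M : Type*} [AddCommGroup M]

/-- The coefficient sum computing `Res_z (z - w) ^ k L(z, w)` for an expansion of `(z - w) ^ k` with
coefficients `c`. -/
def residue (c : ℤ → ℤ) (k : ℤ) (L : ℤ → ℤ → M) (N : ℤ) : M :=
  ∑ᶠ s, c s • L s (N + (k - s))

theorem hasFiniteSupport_outer (k T a : ℤ) {L : ℤ → ℤ → M} {B : ℤ}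
    (hL : ∀ m n, B ≤ n → L m n = 0) :
    Function.HasFiniteSupport fun s => outerCoeff k s • L (s + a) (T - s) := by
  refine hasFiniteSupport_of_bounds (T - B) k fun s hs => ?_
  rcases hs with hs | hs
  · rw [hL _ _ (by omega), smul_zero]
  · rw [outerCoeff_of_lt hs, zero_smul]

theorem hasFiniteSupport_inner (k T a : ℤ) {L : ℤ → ℤ → M} {B : ℤ}
    (hL : ∀ m, B ≤ m → ∀ n, L m n = 0) :
    Function.HasFiniteSupport fun s => innerCoeff k s • L (s + a) (T - s) := by
  refine hasFiniteSupport_of_bounds 0 (B - a) fun s hs => ?_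
  rcases hs with hs | hs
  · rw [innerCoeff_of_neg hs, zero_smul]
  · rw [hL _ (by omega), smul_zero]

/-- A factor $z-w$ can be moved from the distribution to the expansion by reindexing one of the two
sums; the finiteness hypothesis allows the sums to be separated. -/
theorem residue_diff {c c' : ℤ → ℤ} (hc : ∀ s, c' s = c (s - 1) - c s) (k : ℤ) (L : ℤ → ℤ → M)
    (hL : ∀ T a, Function.HasFiniteSupport fun s => c s • L (s + a) (T - s)) (N : ℤ) :
    residue c k (diff L) N = residue c' (k + 1) L N := by
  have h1 : Function.HasFiniteSupport fun s => c s • L (s + 1) (N + k - s) := hL _ _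
  have h2 : Function.HasFiniteSupport fun s => c s • L s (N + k + 1 - s) := by
    simpa using hL (N + k + 1) 0
  have h3 : Function.HasFiniteSupport fun s => c (s - 1) • L s (N + k + 1 - s) := by
    have := h1.comp_of_injective (g := fun s => s - 1) (sub_left_injective)
    convert this using 2 with s
    simp only [Function.comp_apply]
    rw [sub_add_cancel]
    congr 2
    ring
  have e1 : residue c k (diff L) N = (∑ᶠ s, c s • L (s + 1) (N + k - s)) -
      ∑ᶠ s, c s • L s (N + k + 1 - s) := by
    rw [← finsum_sub_distrib h1 h2]
    refine finsum_congr fun s => ?_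
    rw [diff, smul_sub]
    congr 3 <;> ring
  have e2 : residue c' (k + 1) L N = (∑ᶠ s, c (s - 1) • L s (N + k + 1 - s)) -
      ∑ᶠ s, c s • L s (N + k + 1 - s) := by
    rw [← finsum_sub_distrib h3 h2]
    refine finsum_congr fun s => ?_
    rw [hc, sub_smul]
    congr 3 <;> ring
  rw [e1, e2]
  congr 1
  rw [← finsum_comp_equiv (Equiv.addRight (1 : ℤ))
    (f := fun s => c (s - 1) • L s (N + k + 1 - s))]
  refine finsum_congr fun s => ?_
  simp only [Equiv.coe_addRight, add_sub_cancel_right]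
  congr 2
  ring

theorem residue_outer_iterate_diff (J : ℕ) (k : ℤ) {L : ℤ → ℤ → M} {B : ℤ}
    (hL : ∀ m n, B ≤ n → L m n = 0) (N : ℤ) :
    residue (outerCoeff k) k (diff^[J] L) N = residue (outerCoeff (k + J)) (k + J) L N := by
  induction J generalizing k with
  | zero => simp
  | succ J ih =>
    rw [show k + (J + 1 : ℕ) = k + 1 + J by push_cast; ring, ← ih,
      Function.iterate_succ_apply', residue_diff (outerCoeff_add_one k) k _
      (fun T a => hasFiniteSupport_outer k T a (iterate_diff_right_eq_zero J hL))]

theorem residue_inner_iterate_diff (J : ℕ) (k : ℤ) {L : ℤ → ℤ → M} {B : ℤ}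
    (hL : ∀ m, B ≤ m → ∀ n, L m n = 0) (N : ℤ) :
    residue (innerCoeff k) k (diff^[J] L) N = residue (innerCoeff (k + J)) (k + J) L N := by
  induction J generalizing k with
  | zero => simp
  | succ J ih =>
    rw [show k + (J + 1 : ℕ) = k + 1 + J by push_cast; ring, ← ih,
      Function.iterate_succ_apply', residue_diff (innerCoeff_add_one k) k _
      (fun T a => hasFiniteSupport_inner k T a (iterate_diff_left_eq_zero J hL))]

theorem residue_outer_sub_inner (k : ℤ) {L : ℤ → ℤ → M} {B B' : ℤ}
    (hL : ∀ m n, B ≤ n → L m n = 0) (hL' : ∀ m, B' ≤ m → ∀ n, L m n = 0) (N : ℤ) :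
    residue (outerCoeff k) k L N - residue (innerCoeff k) k L N =
      residue (deltaCoeff k) k L N := by
  have h1 : Function.HasFiniteSupport fun s => outerCoeff k s • L s (N + (k - s)) := by
    simpa [add_sub_assoc] using hasFiniteSupport_outer k (N + k) 0 hL
  have h2 : Function.HasFiniteSupport fun s => innerCoeff k s • L s (N + (k - s)) := by
    simpa [add_sub_assoc] using hasFiniteSupport_inner k (N + k) 0 hL'
  rw [residue, residue, ← finsum_sub_distrib h1 h2]
  exact finsum_congr fun s => (sub_smul _ _ _).symm

theorem finsum_comp_of_injective {ι κ : Type*} {g : ι → κ} (hg : Function.Injective g) (f : κ → M)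
    (hf : ∀ x, x ∉ Set.range g → f x = 0) : ∑ᶠ i, f (g i) = ∑ᶠ x, f x := by
  rw [← finsum_mem_range hg]
  refine finsum_congr fun x => ?_
  by_cases hx : x ∈ Set.range g
  · simp [hx]
  · rw [hf x hx]
    simp

end Residue

/-! ### Residue products of mutually local fields. -/

variable {V : Type*} [AddCommGroup V] [Module ℂ V]

theorem field_ext {A B : VertexOperator ℂ V} (h : ∀ n v, ncoeff A n v = ncoeff B n v) : A = B := by
  refine HVertexOperator.coeff_inj (funext fun n => LinearMap.ext fun v => ?_)
  have := h (-n - 1) v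
  rwa [ncoeff_apply, ncoeff_apply, neg_sub, sub_neg_eq_add, add_sub_cancel_left] at this

theorem ncoeff_prod (p : ℤ) (A B : VertexOperator ℂ V) (N : ℤ) (v : V) :
    ncoeff (prod p A B) N v =
      residue (outerCoeff (p - 1)) (p - 1) (fun s n => ncoeff A s (ncoeff B n v)) N -
        residue (innerCoeff (p - 1)) (p - 1) (fun s n => ncoeff B n (ncoeff A s v)) N := by
  obtain ⟨a, ha⟩ := exists_ncoeff_eq_zero A v
  obtain ⟨b, hb⟩ := exists_ncoeff_eq_zero B v
  set k := p - 1
  -- The sum over `j` is reindexed by the exponent of `z`, which is `k - j` in the outer expansion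
  -- and `j` in the inner one.
  have hterm (j : ℕ) : resTerm k A B N j v =
      outerCoeff k (k - j) • ncoeff A (k - j) (ncoeff B (N + (k - (k - j))) v) -
        innerCoeff k j • ncoeff B (N + (k - j)) (ncoeff A (j : ℤ) v) := by
    rw [outerCoeff, if_pos (by omega), innerCoeff, if_pos (by omega),
      show (k - (k - j)).toNat = j by omega, show (j : ℤ).toNat = j by omega,
      show N + (k - (k - j)) = N + j by ring, show N + (k - j) = N + k - j by ring]
    simp only [resTerm, LinearMap.smul_apply, LinearMap.sub_apply, Module.End.mul_apply, smul_sub,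
      smul_smul]
  have hinj : Function.Injective fun j : ℕ => k - j := fun i j h => by simpa using h
  have hinj' : Function.Injective fun j : ℕ => (j : ℤ) := Nat.cast_injective
  have h1 := (hasFiniteSupport_outer k (N + k) 0 (L := fun s n => ncoeff A s (ncoeff B n v))
    (B := b) (fun m n hn => by rw [hb n hn, map_zero])).comp_of_injective hinj
  have h2 := (hasFiniteSupport_inner k (N + k) 0 (L := fun s n => ncoeff B n (ncoeff A s v))
    (B := a) (fun m hm n => by rw [ha m hm, map_zero])).comp_of_injective hinj'
  simp only [Function.comp_def, add_zero, add_sub_assoc] at h1 h2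
  rw [prod, ncoeff_ofModes]
  change ∑ᶠ j : ℕ, resTerm k A B N j v = _
  simp only [hterm]
  rw [finsum_sub_distrib h1 h2]
  congr 1
  · refine finsum_comp_of_injective hinj
      (fun s => outerCoeff k s • ncoeff A s (ncoeff B (N + (k - s)) v)) fun s hs => ?_
    rw [outerCoeff_of_lt, zero_smul]
    by_contra h
    exact hs ⟨(k - s).toNat, by simp only; omega⟩
  · refine finsum_comp_of_injective hinj'
      (fun s => innerCoeff k s • ncoeff B (N + (k - s)) (ncoeff A s v)) fun s hs => ?_
    rw [innerCoeff_of_neg, zero_smul]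
    by_contra h
    exact hs ⟨s.toNat, by simp only; omega⟩

/-- `(z - w) ^ J [A(z), B(w)] = 0`. -/
def IsLocal (J : ℕ) (A B : VertexOperator ℂ V) : Prop :=
  diff^[J] (fun m n => ncoeff A m * ncoeff B n - ncoeff B n * ncoeff A m) = 0

theorem IsLocal.iterate_diff_eq {J : ℕ} {A B : VertexOperator ℂ V} (h : IsLocal J A B) :
    diff^[J] (fun m n => ncoeff A m * ncoeff B n) = diff^[J] (fun m n => ncoeff B n * ncoeff A m) := by
  rw [← sub_eq_zero, ← iterate_diff_sub]
  exact h

theorem isLocal_zero_iff {A B : VertexOperator ℂ V} :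
    IsLocal 0 A B ↔ ∀ m n v, ncoeff A m (ncoeff B n v) = ncoeff B n (ncoeff A m v) := by
  refine ⟨fun h m n v => ?_, fun h => ?_⟩
  · exact sub_eq_zero.mp (LinearMap.congr_fun (congrFun (congrFun h m) n) v)
  · ext m n v
    exact sub_eq_zero.mpr (h m n v)

theorem IsLocal.symm {A B : VertexOperator ℂ V} (h : IsLocal 0 A B) : IsLocal 0 B A :=
  isLocal_zero_iff.mpr fun m n v => (isLocal_zero_iff.mp h n m v).symm

theorem iterate_diff_apply (J : ℕ) (f : ℤ → ℤ → Module.End ℂ V) (m n : ℤ) (v : V) :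
    diff^[J] (fun m n => f m n v) m n = diff^[J] f m n v :=
  iterate_diff_map (LinearMap.applyₗ v).toAddMonoidHom J f m n

/-- Take $(z-w)^J$ out of the expansions and into the operator products. The two orderings then
agree, and this common distribution is bounded in both indices on each vector, so the two residues
combine into one. -/
theorem IsLocal.ncoeff_prod {J : ℕ} {A B : VertexOperator ℂ V} (h : IsLocal J A B) (p N : ℤ)
    (v : V) :
    ncoeff (prod p A B) N v = residue (deltaCoeff (p - 1 - J)) (p - 1 - J)
      (fun s n => diff^[J] (fun m n => ncoeff A m * ncoeff B n) s n v) N := by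
  obtain ⟨a, ha⟩ := exists_ncoeff_eq_zero A v
  obtain ⟨b, hb⟩ := exists_ncoeff_eq_zero B v
  have hout : ∀ m n, b ≤ n → (ncoeff A m * ncoeff B n) v = 0 := fun m n hn => by
    rw [Module.End.mul_apply, hb n hn, map_zero]
  have hinn : ∀ m, a ≤ m → ∀ n, (ncoeff B n * ncoeff A m) v = 0 := fun m hm n => by
    rw [Module.End.mul_apply, ha m hm, map_zero]
  have h1 := residue_outer_iterate_diff J (p - 1 - J) hout N
  have h2 := residue_inner_iterate_diff J (p - 1 - J) hinn N
  have hL := iterate_diff_right_eq_zero J hout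
  have hL' := iterate_diff_left_eq_zero J hinn
  have e1 := funext₂ (iterate_diff_apply J (fun m n => ncoeff A m * ncoeff B n) · · v)
  have e2 := funext₂ (iterate_diff_apply J (fun m n => ncoeff B n * ncoeff A m) · · v)
  rw [← h.iterate_diff_eq] at e2
  rw [e1] at h1 hL
  rw [e2] at h2 hL'
  rw [sub_add_cancel] at h1 h2
  rw [SymplecticBoson.ncoeff_prod, ← residue_outer_sub_inner _ hL hL', h1, h2]
  rfl

theorem IsLocal.prod_eq_zero {J : ℕ} {A B : VertexOperator ℂ V} (h : IsLocal J A B) {p : ℤ}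
    (hp : J < p) : prod p A B = 0 := by
  refine field_ext fun N v => ?_
  simp [h.ncoeff_prod, residue, deltaCoeff_of_nonneg (show 0 ≤ p - 1 - J by omega)]

/-- Since $A$ commutes with $B$, its commutator with $(BC)_p$ is a combination of modes of $B$ with
$[A,C]$, and $(z-w)^J$ acts only on the latter. -/
theorem IsLocal.prod_right {J : ℕ} {A B C : VertexOperator ℂ V} (hAC : IsLocal J A C)
    (hAB : IsLocal 0 A B) (p : ℤ) : IsLocal J A (prod p B C) := by
  have hcomm := isLocal_zero_iff.mp hAB
  refine funext₂ fun m n => LinearMap.ext fun v => ?_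
  rw [← iterate_diff_apply]
  set k := p - 1
  set K : ℤ → ℤ → Module.End ℂ V := fun m n => ncoeff A m * ncoeff C n - ncoeff C n * ncoeff A m with hK
  have hfin1 (n : ℤ) (u : V) (Φ : Module.End ℂ V) : Function.HasFiniteSupport fun s =>
      outerCoeff k s • Φ (ncoeff B s (ncoeff C (n + (k - s)) u)) := by
    obtain ⟨c, hc⟩ := exists_ncoeff_eq_zero C u
    simpa [add_sub_assoc] using hasFiniteSupport_outer k (n + k) 0
      (L := fun s n => Φ (ncoeff B s (ncoeff C n u))) (B := c) (fun m n hn => by simp [hc n hn])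
  have hfin2 (n : ℤ) (u : V) (Φ : Module.End ℂ V) : Function.HasFiniteSupport fun s =>
      innerCoeff k s • Φ (ncoeff C (n + (k - s)) (ncoeff B s u)) := by
    obtain ⟨b, hb⟩ := exists_ncoeff_eq_zero B u
    simpa [add_sub_assoc] using hasFiniteSupport_inner k (n + k) 0
      (L := fun s n => Φ (ncoeff C n (ncoeff B s u))) (B := b) (fun m hm n => by simp [hb m hm])
  have hterm1 (m n s : ℤ) : outerCoeff k s • ncoeff B s (K m (n + (k - s)) v) =
      outerCoeff k s • ncoeff A m (ncoeff B s (ncoeff C (n + (k - s)) v)) -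
        outerCoeff k s • (1 : Module.End ℂ V) (ncoeff B s (ncoeff C (n + (k - s)) (ncoeff A m v))) := by
    simp [hK, hcomm, smul_sub]
  have hterm2 (m n s : ℤ) : innerCoeff k s • K m (n + (k - s)) (ncoeff B s v) =
      innerCoeff k s • ncoeff A m (ncoeff C (n + (k - s)) (ncoeff B s v)) -
        innerCoeff k s • (1 : Module.End ℂ V) (ncoeff C (n + (k - s)) (ncoeff B s (ncoeff A m v))) := by
    simp [hK, hcomm, smul_sub]
  have h1 : (fun m n => (ncoeff A m * ncoeff (prod p B C) n - ncoeff (prod p B C) n * ncoeff A m) v) =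
      (fun m n => ∑ᶠ s, outerCoeff k s • ncoeff B s (K m (n + (k - s)) v)) -
        fun m n => ∑ᶠ s, innerCoeff k s • K m (n + (k - s)) (ncoeff B s v) := by
    ext m n
    have e1 : ncoeff A m (residue (outerCoeff k) k (fun s n => ncoeff B s (ncoeff C n v)) n) =
        ∑ᶠ s, outerCoeff k s • ncoeff A m (ncoeff B s (ncoeff C (n + (k - s)) v)) := by
      refine (map_finsum (ncoeff A m) (hfin1 n v 1)).trans (finsum_congr fun s => ?_)
      rw [map_zsmul, Module.End.one_apply]
    have e2 : ncoeff A m (residue (innerCoeff k) k (fun s n => ncoeff C n (ncoeff B s v)) n) =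
        ∑ᶠ s, innerCoeff k s • ncoeff A m (ncoeff C (n + (k - s)) (ncoeff B s v)) := by
      refine (map_finsum (ncoeff A m) (hfin2 n v 1)).trans (finsum_congr fun s => ?_)
      rw [map_zsmul, Module.End.one_apply]
    simp only [Pi.sub_apply, hterm1, hterm2]
    rw [finsum_sub_distrib (hfin1 n v _) (hfin1 n _ 1),
      finsum_sub_distrib (hfin2 n v _) (hfin2 n _ 1), LinearMap.sub_apply, Module.End.mul_apply,
      Module.End.mul_apply, SymplecticBoson.ncoeff_prod, SymplecticBoson.ncoeff_prod, map_sub,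
      e1, e2]
    simp only [residue, Module.End.one_apply]
    abel
  rw [h1, iterate_diff_sub, Pi.sub_apply, Pi.sub_apply,
    iterate_diff_finsum J (outerCoeff k) (fun s => k - s) (fun s m n => ncoeff B s (K m n v)),
    iterate_diff_finsum J (innerCoeff k) (fun s => k - s) (fun s m n => K m n (ncoeff B s v))]
  · have e1 (s m n : ℤ) : diff^[J] (fun m n => ncoeff B s (K m n v)) m n = 0 := by
      have := iterate_diff_map (ncoeff B s).toAddMonoidHom J (fun m n => K m n v) m n
      simp only [LinearMap.toAddMonoidHom_coe] at this
      rw [this, iterate_diff_apply, show diff^[J] K = 0 from hAC]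
      simp
    have e2 (s m n : ℤ) : diff^[J] (fun m n => K m n (ncoeff B s v)) m n = 0 := by
      rw [iterate_diff_apply, show diff^[J] K = 0 from hAC]
      simp
    simp [e1, e2]
  · intro m n
    simp only [hterm2]
    exact (hfin2 n v _).sub (hfin2 n _ 1)
  · intro m n
    simp only [hterm1]
    exact (hfin1 n v _).sub (hfin1 n _ 1)

/-! ### Distributions in three variables and their restriction to $z=y$. -/

section TripleDifference

variable {M M' : Type*} [AddCommGroup M] [AddCommGroup M']

/-- Multiplication by `z - w` of a formal distribution in `z`, `y`, `w`. -/
def diffFst (f : ℤ → ℤ → ℤ → M) (a b n : ℤ) : M := f (a + 1) b n - f a b (n + 1)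

/-- Multiplication by `y - w` of a formal distribution in `z`, `y`, `w`. -/
def diffSnd (f : ℤ → ℤ → ℤ → M) (a b n : ℤ) : M := f a (b + 1) n - f a b (n + 1)

theorem iterate_diffFst_apply (J : ℕ) (f : ℤ → ℤ → ℤ → M) (a b n : ℤ) :
    diffFst^[J] f a b n = diff^[J] (fun a n => f a b n) a n := by
  induction J generalizing f with
  | zero => rfl
  | succ J ih =>
    rw [Function.iterate_succ_apply, Function.iterate_succ_apply, ih]
    rfl

theorem iterate_diffSnd_apply (J : ℕ) (f : ℤ → ℤ → ℤ → M) (a b n : ℤ) :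
    diffSnd^[J] f a b n = diff^[J] (f a) b n := by
  induction J generalizing f with
  | zero => rfl
  | succ J ih =>
    rw [Function.iterate_succ_apply, Function.iterate_succ_apply, ih]
    rfl

theorem diffFst_commute_diffSnd :
    Function.Commute (diffFst : (ℤ → ℤ → ℤ → M) → _) diffSnd := by
  intro f
  ext a b n
  simp only [diffFst, diffSnd]
  abel

theorem iterate_diffFst_diffSnd (J K : ℕ) (f : ℤ → ℤ → ℤ → M) :
    diffFst^[J] (diffSnd^[K] f) = diffSnd^[K] (diffFst^[J] f) :=
  (diffFst_commute_diffSnd.iterate_iterate J K) f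

theorem iterate_diffFst_map (φ : M →+ M') (J : ℕ) (f : ℤ → ℤ → ℤ → M) :
    diffFst^[J] (fun a b n => φ (f a b n)) = fun a b n => φ (diffFst^[J] f a b n) := by
  ext a b n
  rw [iterate_diffFst_apply, iterate_diffFst_apply]
  exact iterate_diff_map φ J (fun a n => f a b n) a n

theorem iterate_diffSnd_map (φ : M →+ M') (J : ℕ) (f : ℤ → ℤ → ℤ → M) :
    diffSnd^[J] (fun a b n => φ (f a b n)) = fun a b n => φ (diffSnd^[J] f a b n) := by
  ext a b n
  rw [iterate_diffSnd_apply, iterate_diffSnd_apply]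
  exact iterate_diff_map φ J (f a) b n

theorem iterate_diffFst_swap (J : ℕ) (f : ℤ → ℤ → ℤ → M) :
    diffFst^[J] (fun a b n => f b a n) = fun a b n => diffSnd^[J] f b a n := by
  ext a b n
  rw [iterate_diffFst_apply, iterate_diffSnd_apply]

theorem iterate_diffSnd_swap (J : ℕ) (f : ℤ → ℤ → ℤ → M) :
    diffSnd^[J] (fun a b n => f b a n) = fun a b n => diffFst^[J] f b a n := by
  ext a b n
  rw [iterate_diffFst_apply, iterate_diffSnd_apply]

theorem iterate_diffFst_diffSnd_eq_zero (J K : ℕ) {f : ℤ → ℤ → ℤ → M} {S : ℤ → ℤ → ℤ → Prop}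
    (hf : ∀ a b n, S a b n → f a b n = 0) (h1 : ∀ a b n, S a b n → S (a + 1) b n)
    (h2 : ∀ a b n, S a b n → S a (b + 1) n) (h3 : ∀ a b n, S a b n → S a b (n + 1)) :
    ∀ a b n, S a b n → diffFst^[J] (diffSnd^[K] f) a b n = 0 := by
  have hK : ∀ a b n, S a b n → diffSnd^[K] f a b n = 0 := by
    induction K generalizing f with
    | zero => exact hf
    | succ K ih =>
      rw [Function.iterate_succ_apply]
      refine ih fun a b n h => ?_
      rw [diffSnd, hf _ _ _ (h2 _ _ _ h), hf _ _ _ (h3 _ _ _ h), sub_zero]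
  generalize diffSnd^[K] f = g at hK
  induction J generalizing g with
  | zero => exact hK
  | succ J ih =>
    rw [Function.iterate_succ_apply]
    refine ih _ fun a b n h => ?_
    rw [diffFst, hK _ _ _ (h1 _ _ _ h), hK _ _ _ (h3 _ _ _ h), sub_zero]

/-- The modes of the restriction of a formal distribution in `z`, `y`, `w` to `z = y`. -/
def diag (f : ℤ → ℤ → ℤ → M) (s n : ℤ) : M := ∑ᶠ a, f a (s - 1 - a) n

theorem diff_diag_fst {f : ℤ → ℤ → ℤ → M}
    (hf : ∀ s n, Function.HasFiniteSupport fun a => f a (s - 1 - a) n) :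
    diff (diag f) = diag (diffFst f) ∧
      ∀ s n, Function.HasFiniteSupport fun a => diffFst f a (s - 1 - a) n := by
  have h (s n : ℤ) : Function.HasFiniteSupport fun a => f (a + 1) (s - 1 - a) n := by
    have := (hf (s + 1) n).comp_of_injective (g := fun a => a + 1) (add_left_injective 1)
    convert this using 2 with a
    simp only [Function.comp_apply]
    congr 1
    ring
  refine ⟨?_, fun s n => (h s n).sub (hf s (n + 1))⟩
  ext s n
  simp only [diff, diag, diffFst]
  rw [finsum_sub_distrib (h s n) (hf s (n + 1)), ← finsum_comp_equiv (Equiv.addRight (1 : ℤ))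
    (f := fun a => f a (s + 1 - 1 - a) n)]
  congr 1
  refine finsum_congr fun a => ?_
  simp only [Equiv.coe_addRight]
  congr 1
  ring

theorem diff_diag_snd {f : ℤ → ℤ → ℤ → M}
    (hf : ∀ s n, Function.HasFiniteSupport fun a => f a (s - 1 - a) n) :
    diff (diag f) = diag (diffSnd f) ∧
      ∀ s n, Function.HasFiniteSupport fun a => diffSnd f a (s - 1 - a) n := by
  have e (s a : ℤ) : s - 1 - a + 1 = s + 1 - 1 - a := by ring
  have h (s n : ℤ) : Function.HasFiniteSupport fun a => f a (s - 1 - a + 1) n := by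
    simp only [e]
    exact hf (s + 1) n
  refine ⟨?_, fun s n => (h s n).sub (hf s (n + 1))⟩
  ext s n
  simp only [diff, diag, diffSnd]
  rw [finsum_sub_distrib (h s n) (hf s (n + 1))]
  simp only [e]

/-- On $z=y$ the factors $z-w$ and $y-w$ become the same, so their exponents add. -/
theorem iterate_diff_diag (J K : ℕ) {f : ℤ → ℤ → ℤ → M}
    (hf : ∀ s n, Function.HasFiniteSupport fun a => f a (s - 1 - a) n) :
    diff^[J + K] (diag f) = diag (diffFst^[J] (diffSnd^[K] f)) := by
  have hK : diff^[K] (diag f) = diag (diffSnd^[K] f) ∧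
      ∀ s n, Function.HasFiniteSupport fun a => diffSnd^[K] f a (s - 1 - a) n := by
    induction K generalizing f with
    | zero => exact ⟨rfl, hf⟩
    | succ K ih =>
      obtain ⟨h1, h2⟩ := diff_diag_snd hf
      rw [Function.iterate_succ_apply, Function.iterate_succ_apply, h1]
      exact ih h2
  obtain ⟨h1, h2⟩ := hK
  rw [Function.iterate_add_apply, h1]
  generalize diffSnd^[K] f = g at h2
  induction J generalizing g with
  | zero => rfl
  | succ J ih =>
    obtain ⟨h3, h4⟩ := diff_diag_fst h2
    rw [Function.iterate_succ_apply, Function.iterate_succ_apply, h3]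
    exact ih _ h4

/-- Three upper bounds on integers of fixed sum leave a finite triangle. -/
theorem hasFiniteSupport_prod_of_bounds {f : ℤ × ℤ → M} (B T : ℤ)
    (h : ∀ a b, B ≤ a ∨ B ≤ b ∨ B ≤ T - a - b → f (a, b) = 0) : Function.HasFiniteSupport f := by
  refine ((Set.finite_Icc (T - 2 * B) B).prod (Set.finite_Icc (T - 2 * B) B)).subset
    fun x hx => ?_
  by_contra h'
  refine hx (h x.1 x.2 ?_)
  rw [Set.mem_prod, Set.mem_Icc, Set.mem_Icc] at h'
  omega

end TripleDifference

/-! ### The kernel of three fields; exchange and associativity of products. -/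

variable {J K : ℕ} {A B C : VertexOperator ℂ V}

/-- The modes of `(z - w) ^ J (y - w) ^ K A(z) B(y) C(w)`. -/
def tripleKernel (J K : ℕ) (A B C : VertexOperator ℂ V) : ℤ → ℤ → ℤ → Module.End ℂ V :=
  diffFst^[J] (diffSnd^[K] fun a b n => ncoeff A a * ncoeff B b * ncoeff C n)

theorem IsLocal.ncoeff_mul_comm (h : IsLocal 0 A B) (m n : ℤ) :
    ncoeff A m * ncoeff B n = ncoeff B n * ncoeff A m :=
  LinearMap.ext fun v => isLocal_zero_iff.mp h m n v

theorem tripleKernel_swap (hAB : IsLocal 0 A B) (a b n : ℤ) :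
    tripleKernel J K A B C a b n = tripleKernel K J B A C b a n := by
  rw [tripleKernel, tripleKernel]
  simp only [hAB.ncoeff_mul_comm]
  rw [iterate_diffSnd_swap K fun b a n => ncoeff B b * ncoeff A a * ncoeff C n,
    iterate_diffFst_swap, iterate_diffFst_diffSnd]

theorem tripleKernel_apply (a b n : ℤ) : tripleKernel J K A B C a b n =
    diff^[J] (fun a n => ncoeff A a * diff^[K] (fun b n => ncoeff B b * ncoeff C n) b n) a n := by
  rw [tripleKernel, iterate_diffFst_apply]
  have h : (fun a n => diffSnd^[K] (fun a b n => ncoeff A a * ncoeff B b * ncoeff C n) a b n) =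
      fun a n => ncoeff A a * diff^[K] (fun b n => ncoeff B b * ncoeff C n) b n := by
    funext a n
    rw [iterate_diffSnd_apply]
    simp only [mul_assoc]
    exact iterate_diff_map (AddMonoidHom.mulLeft (ncoeff A a)) K
      (fun b n => ncoeff B b * ncoeff C n) b n
  rw [h]

/-- The factor $(y-w)^K$ lets $C$ pass $B$, then $(z-w)^J$ lets it pass $A$. -/
theorem tripleKernel_eq (hAB : IsLocal 0 A B) (hAC : IsLocal J A C) (hBC : IsLocal K B C) :
    tripleKernel J K A B C =
      diffFst^[J] (diffSnd^[K] fun a b n => ncoeff C n * ncoeff B b * ncoeff A a) := by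
  have h1 : (diffSnd^[K] fun a b n => ncoeff A a * ncoeff B b * ncoeff C n) =
      diffSnd^[K] fun a b n => ncoeff A a * ncoeff C n * ncoeff B b := by
    ext a b n : 3
    rw [iterate_diffSnd_apply, iterate_diffSnd_apply]
    simp only [mul_assoc]
    have e1 := iterate_diff_map (AddMonoidHom.mulLeft (ncoeff A a)) K
      (fun b n => ncoeff B b * ncoeff C n) b n
    have e2 := iterate_diff_map (AddMonoidHom.mulLeft (ncoeff A a)) K
      (fun b n => ncoeff C n * ncoeff B b) b n
    rw [hBC.iterate_diff_eq] at e1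
    exact e1.trans e2.symm
  have h2 : (diffFst^[J] fun a b n => ncoeff A a * ncoeff C n * ncoeff B b) =
      diffFst^[J] fun a b n => ncoeff C n * ncoeff B b * ncoeff A a := by
    ext a b n : 3
    rw [iterate_diffFst_apply, iterate_diffFst_apply]
    have e1 := iterate_diff_map (AddMonoidHom.mulRight (ncoeff B b)) J
      (fun a n => ncoeff A a * ncoeff C n) a n
    have e2 := iterate_diff_map (AddMonoidHom.mulRight (ncoeff B b)) J
      (fun a n => ncoeff C n * ncoeff A a) a n
    rw [hAC.iterate_diff_eq] at e1
    simp only [mul_assoc, ← hAB.ncoeff_mul_comm]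
    simp only [AddMonoidHom.mulRight_apply, mul_assoc] at e1 e2
    exact e1.trans e2.symm
  rw [tripleKernel, h1, iterate_diffFst_diffSnd, h2, iterate_diffFst_diffSnd]

/-- To bound one index, choose an ordering in which the corresponding field acts first on the
vector. -/
theorem tripleKernel_bound (hAB : IsLocal 0 A B) (hAC : IsLocal J A C) (hBC : IsLocal K B C)
    (v : V) : ∃ M : ℤ, ∀ a b n, M ≤ a ∨ M ≤ b ∨ M ≤ n → tripleKernel J K A B C a b n v = 0 := by
  obtain ⟨Ma, ha⟩ := exists_ncoeff_eq_zero A v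
  obtain ⟨Mb, hb⟩ := exists_ncoeff_eq_zero B v
  obtain ⟨Mc, hc⟩ := exists_ncoeff_eq_zero C v
  have happ (f : ℤ → ℤ → ℤ → Module.End ℂ V) (a b n : ℤ) :
      diffFst^[J] (diffSnd^[K] fun a b n => f a b n v) a b n =
        diffFst^[J] (diffSnd^[K] f) a b n v := by
    have e1 := iterate_diffSnd_map (LinearMap.applyₗ (R := ℂ) (M₂ := V) v).toAddMonoidHom K f
    have e2 := iterate_diffFst_map (LinearMap.applyₗ (R := ℂ) (M₂ := V) v).toAddMonoidHom J
      (diffSnd^[K] f)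
    rw [← e1] at e2
    exact congrFun (congrFun (congrFun e2 a) b) n
  refine ⟨max Ma (max Mb Mc), fun a b n h => ?_⟩
  rcases h with h | h | h
  · rw [tripleKernel_eq hAB hAC hBC, ← happ]
    refine iterate_diffFst_diffSnd_eq_zero J K (S := fun a b n => Ma ≤ a) (fun a b n h => ?_)
      (by intros; omega) (by intros; omega) (by intros; omega) a b n (by omega)
    simp [ha a h]
  · rw [tripleKernel_eq hAB hAC hBC, ← happ]
    refine iterate_diffFst_diffSnd_eq_zero J K (S := fun a b n => Mb ≤ b) (fun a b n h => ?_)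
      (by intros; omega) (by intros; omega) (by intros; omega) a b n (by omega)
    rw [mul_assoc, ← hAB.ncoeff_mul_comm]
    simp [hb b h]
  · rw [tripleKernel, ← happ]
    refine iterate_diffFst_diffSnd_eq_zero J K (S := fun a b n => Mc ≤ n) (fun a b n h => ?_)
      (by intros; omega) (by intros; omega) (by intros; omega) a b n (by omega)
    simp [hc n h]

theorem IsLocal.hasFiniteSupport (h : IsLocal K B C) (k N : ℤ) (v : V) :
    Function.HasFiniteSupport fun t => deltaCoeff k t •
      diff^[K] (fun m n => ncoeff B m * ncoeff C n) t (N + (k - t)) v := by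
  obtain ⟨b, hb⟩ := exists_ncoeff_eq_zero B v
  obtain ⟨c, hc⟩ := exists_ncoeff_eq_zero C v
  have h1 := iterate_diff_right_eq_zero K (B := c)
    (f := fun m n => (ncoeff B m * ncoeff C n) v) (fun m n hn => by simp [hc n hn])
  have h2 := iterate_diff_left_eq_zero K (B := b)
    (f := fun m n => (ncoeff C n * ncoeff B m) v) (fun m hm n => by simp [hb m hm])
  refine hasFiniteSupport_of_bounds (N + k - c) b fun s hs => ?_
  rcases hs with hs | hs
  · rw [← iterate_diff_apply K (fun m n => ncoeff B m * ncoeff C n), h1 _ _ (by omega), smul_zero]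
  · rw [h.iterate_diff_eq, ← iterate_diff_apply K (fun m n => ncoeff C n * ncoeff B m),
      h2 _ (by omega), smul_zero]

/-- The nested product as a double residue of the kernel; apart from the delta coefficients it no
longer depends on the order of nesting. -/
theorem ncoeff_prod_prod (hAB : IsLocal 0 A B) (hAC : IsLocal J A C) (hBC : IsLocal K B C)
    (i j N : ℤ) (v : V) :
    ncoeff (prod (i + 1 + J) A (prod (j + 1 + K) B C)) N v =
      ∑ᶠ x : ℤ × ℤ, (deltaCoeff i x.1 * deltaCoeff j x.2) •
        tripleKernel J K A B C x.1 x.2 (N + i + j - x.1 - x.2) v := by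
  set F := prod (j + 1 + K) B C with hF
  set G := diff^[K] (fun m n => ncoeff B m * ncoeff C n) with hG
  have hj : j + 1 + K - 1 - K = j := by ring
  have hi : i + 1 + J - 1 - J = i := by ring
  have hFn (m n : ℤ) : (ncoeff A m * ncoeff F n) v =
      ∑ᶠ t, deltaCoeff j t • (ncoeff A m * G t (n + (j - t))) v := by
    rw [Module.End.mul_apply, hF, hBC.ncoeff_prod, hj, residue,
      map_finsum _ (hBC.hasFiniteSupport j n v)]
    simp [hG]
  have hinner (s n : ℤ) : diff^[J] (fun m n => ncoeff A m * ncoeff F n) s n v =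
      ∑ᶠ t, deltaCoeff j t • tripleKernel J K A B C s t (n + (j - t)) v := by
    rw [← iterate_diff_apply J (fun m n => ncoeff A m * ncoeff F n)]
    simp only [hFn]
    rw [iterate_diff_finsum J (deltaCoeff j) (fun t => j - t)
      (fun t m n => (ncoeff A m * G t n) v)]
    · refine finsum_congr fun t => ?_
      rw [iterate_diff_apply J (fun m n => ncoeff A m * G t n), tripleKernel_apply]
    · intro m n
      refine (hBC.hasFiniteSupport j n v).subset fun t ht h => ht ?_
      simp only [Module.End.mul_apply] at h ⊢
      rw [← map_zsmul]
      exact (congrArg _ h).trans (map_zero _)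
  obtain ⟨M, hM⟩ := tripleKernel_bound hAB hAC hBC v
  have hfin : Function.HasFiniteSupport fun x : ℤ × ℤ => (deltaCoeff i x.1 * deltaCoeff j x.2) •
      tripleKernel J K A B C x.1 x.2 (N + i + j - x.1 - x.2) v :=
    hasFiniteSupport_prod_of_bounds M (N + i + j) fun a b h => by rw [hM _ _ _ h, smul_zero]
  rw [(hAC.prod_right hAB (j + 1 + K)).ncoeff_prod, hi, residue, finsum_curry _ hfin]
  refine finsum_congr fun s => ?_
  rw [hinner, smul_finsum']
  · refine finsum_congr fun t => ?_
    rw [smul_smul]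
    congr 3
    ring
  · refine hasFiniteSupport_of_bounds (N + (i - s) + j - M) M fun t ht => ?_
    rw [hM _ _ _ (by omega), smul_zero]

theorem prod_left_comm (hAB : IsLocal 0 A B) (hAC : IsLocal J A C) (hBC : IsLocal K B C)
    (p q : ℤ) : prod p A (prod q B C) = prod q B (prod p A C) := by
  refine field_ext fun N v => ?_
  have h1 := ncoeff_prod_prod hAB hAC hBC (p - 1 - J) (q - 1 - K) N v
  have h2 := ncoeff_prod_prod hAB.symm hBC hAC (q - 1 - K) (p - 1 - J) N v
  rw [show p - 1 - J + 1 + (J : ℤ) = p by ring, show q - 1 - K + 1 + (K : ℤ) = q by ring] at h1 h2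
  rw [h1, h2, ← finsum_comp_equiv (Equiv.prodComm ℤ ℤ)]
  refine finsum_congr fun x => ?_
  simp only [Equiv.prodComm_apply, Prod.fst_swap, Prod.snd_swap]
  rw [tripleKernel_swap hAB, mul_comm]
  congr 3
  ring

/-- For commuting fields the normally ordered product is the pointwise product: all coefficients of
$\delta$ equal 1. -/
theorem ncoeff_prod_zero (hAB : IsLocal 0 A B) (s : ℤ) (v : V) :
    ncoeff (prod 0 A B) s v = ∑ᶠ a, ncoeff A a (ncoeff B (s - 1 - a) v) := by
  rw [hAB.ncoeff_prod, residue]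
  refine finsum_congr fun a => ?_
  rw [show (0 - 1 - ((0 : ℕ) : ℤ)) = -1 by simp, deltaCoeff_neg_one, one_smul,
    show s + (-1 - a) = s - 1 - a by ring]
  rfl

theorem hasFiniteSupport_mul (hAB : IsLocal 0 A B) (s : ℤ) (v : V) :
    Function.HasFiniteSupport fun a => ncoeff A a (ncoeff B (s - 1 - a) v) := by
  obtain ⟨a, ha⟩ := exists_ncoeff_eq_zero A v
  obtain ⟨b, hb⟩ := exists_ncoeff_eq_zero B v
  refine hasFiniteSupport_of_bounds (s - 1 - b) a fun t ht => ?_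
  rcases ht with ht | ht
  · rw [hb _ (by omega), map_zero]
  · rw [isLocal_zero_iff.mp hAB, ha _ (by omega), map_zero]

theorem iterate_diff_prod_mul (hAB : IsLocal 0 A B) (s n : ℤ) (v : V) :
    diff^[J + K] (fun s n => ncoeff (prod 0 A B) s * ncoeff C n) s n v =
      ∑ᶠ a, tripleKernel J K A B C a (s - 1 - a) n v := by
  rw [← iterate_diff_apply (J + K) (fun s n => ncoeff (prod 0 A B) s * ncoeff C n)]
  have h : (fun s n => (ncoeff (prod 0 A B) s * ncoeff C n) v) =
      diag fun a b n => (ncoeff A a * ncoeff B b * ncoeff C n) v := by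
    ext s n
    rw [Module.End.mul_apply, ncoeff_prod_zero hAB]
    rfl
  rw [h, iterate_diff_diag J K fun s n => hasFiniteSupport_mul hAB s (ncoeff C n v)]
  refine finsum_congr fun a => ?_
  have e1 := iterate_diffSnd_map (LinearMap.applyₗ (R := ℂ) (M₂ := V) v).toAddMonoidHom K
    fun a b n => ncoeff A a * ncoeff B b * ncoeff C n
  have e2 := iterate_diffFst_map (LinearMap.applyₗ (R := ℂ) (M₂ := V) v).toAddMonoidHom J
    (diffSnd^[K] fun a b n => ncoeff A a * ncoeff B b * ncoeff C n)
  rw [← e1] at e2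
  exact congrFun (congrFun (congrFun e2 a) (s - 1 - a)) n

theorem iterate_diff_mul_prod (hAB : IsLocal 0 A B) (hAC : IsLocal J A C) (hBC : IsLocal K B C)
    (s n : ℤ) (v : V) :
    diff^[J + K] (fun s n => ncoeff C n * ncoeff (prod 0 A B) s) s n v =
      ∑ᶠ a, tripleKernel J K A B C a (s - 1 - a) n v := by
  rw [← iterate_diff_apply (J + K) (fun s n => ncoeff C n * ncoeff (prod 0 A B) s)]
  have h : (fun s n => (ncoeff C n * ncoeff (prod 0 A B) s) v) =
      diag fun a b n => (ncoeff C n * ncoeff B b * ncoeff A a) v := by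
    ext s n
    rw [Module.End.mul_apply, ncoeff_prod_zero hAB, map_finsum _ (hasFiniteSupport_mul hAB s v)]
    refine finsum_congr fun a => ?_
    rw [isLocal_zero_iff.mp hAB]
    rfl
  rw [h, iterate_diff_diag J K, tripleKernel_eq hAB hAC hBC]
  · refine finsum_congr fun a => ?_
    have e1 := iterate_diffSnd_map (LinearMap.applyₗ (R := ℂ) (M₂ := V) v).toAddMonoidHom K
      fun a b n => ncoeff C n * ncoeff B b * ncoeff A a
    have e2 := iterate_diffFst_map (LinearMap.applyₗ (R := ℂ) (M₂ := V) v).toAddMonoidHom J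
      (diffSnd^[K] fun a b n => ncoeff C n * ncoeff B b * ncoeff A a)
    rw [← e1] at e2
    exact congrFun (congrFun (congrFun e2 a) (s - 1 - a)) n
  · intro s n
    refine (hasFiniteSupport_mul hAB s v).subset fun a ha h => ha ?_
    simp only [mul_assoc, ← hAB.ncoeff_mul_comm]
    exact (congrArg (ncoeff C n) h).trans (map_zero (ncoeff C n))

/-- Both orderings, multiplied by $(z-w)^{J+K}$, are the diagonal restriction of the same kernel. -/
theorem IsLocal.prod_zero_left (hAB : IsLocal 0 A B) (hAC : IsLocal J A C) (hBC : IsLocal K B C) :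
    IsLocal (J + K) (prod 0 A B) C := by
  rw [IsLocal]
  refine (iterate_diff_sub _ _ _).trans (funext₂ fun s n => LinearMap.ext fun v => ?_)
  exact sub_eq_zero.mpr ((iterate_diff_prod_mul hAB s n v).trans
    (iterate_diff_mul_prod hAB hAC hBC s n v).symm)

/-- Associativity of the residue products when the inner fields commute. -/
theorem prod_prod_zero_left (hAB : IsLocal 0 A B) (hAC : IsLocal J A C) (hBC : IsLocal K B C)
    (l : ℕ) :
    prod (J + K - l) (prod 0 A B) C =
      ∑ x ∈ Finset.HasAntidiagonal.antidiagonal l,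
        prod (J - x.1) A (prod (K - x.2) B C) := by
  refine field_ext fun N v => ?_
  obtain ⟨M, hM⟩ := tripleKernel_bound hAB hAC hBC v
  have hfin (c : ℤ × ℤ → ℤ) (T : ℤ) : Function.HasFiniteSupport fun x : ℤ × ℤ =>
      c x • tripleKernel J K A B C x.1 x.2 (T - x.1 - x.2) v :=
    hasFiniteSupport_prod_of_bounds M T fun a b h => by rw [hM _ _ _ h, smul_zero]
  have hR : ncoeff (∑ x ∈ Finset.HasAntidiagonal.antidiagonal l,
      prod (J - x.1) A (prod (K - x.2) B C)) N v =
      ∑ᶠ x : ℤ × ℤ, deltaCoeff (-1 - l) (x.1 + x.2 + 1) •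
        tripleKernel J K A B C x.1 x.2 (N - 2 - l - x.1 - x.2) v := by
    rw [map_sum, Finset.sum_apply, LinearMap.sum_apply]
    have hterm (x : ℕ × ℕ) (hx : x ∈ Finset.HasAntidiagonal.antidiagonal l) :
        ncoeff (prod (J - x.1) A (prod (K - x.2) B C)) N v =
        ∑ᶠ y : ℤ × ℤ, (deltaCoeff (-1 - x.1) y.1 * deltaCoeff (-1 - x.2) y.2) •
          tripleKernel J K A B C y.1 y.2 (N - 2 - l - y.1 - y.2) v := by
      rw [Finset.HasAntidiagonal.mem_antidiagonal] at hx
      have := ncoeff_prod_prod hAB hAC hBC (-1 - x.1) (-1 - x.2) N v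
      rw [show (-1 - (x.1 : ℤ) + 1 + J) = J - x.1 by ring,
        show (-1 - (x.2 : ℤ) + 1 + K) = K - x.2 by ring,
        show N + (-1 - (x.1 : ℤ)) + (-1 - x.2) = N - 2 - l by rw [← hx]; push_cast; ring] at this
      exact this
    rw [Finset.sum_congr rfl hterm, sum_finsum_comm _ _ fun x _ => hfin _ _]
    refine finsum_congr fun y => ?_
    rw [← Finset.sum_smul, sum_antidiagonal_deltaCoeff]
  rw [hR, (IsLocal.prod_zero_left hAB hAC hBC).ncoeff_prod,
    show (J + K - l - 1 - ((J + K : ℕ) : ℤ)) = -1 - l by push_cast; ring, residue]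
  simp only [iterate_diff_prod_mul hAB]
  -- A mode `s` of $(AB)_0$ and a mode `a` of $A$ determine the mode `s - 1 - a` of $B$.
  let e : ℤ × ℤ ≃ ℤ × ℤ :=
    { toFun := fun x => (x.2, x.1 - 1 - x.2)
      invFun := fun y => (y.1 + y.2 + 1, y.1)
      left_inv := fun x => by ext <;> simp
      right_inv := fun y => by ext <;> simp }
  rw [← finsum_comp_equiv e]
  have hfin' := (hfin (fun x => deltaCoeff (-1 - l) (x.1 + x.2 + 1)) (N - 2 - l)).comp_of_injective
    e.injective
  refine Eq.trans (finsum_congr fun s => ?_) (finsum_curry _ hfin').symm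
  rw [smul_finsum']
  · refine finsum_congr fun a => ?_
    simp only [e, Function.comp_apply, Equiv.coe_fn_mk]
    rw [show a + (s - 1 - a) + 1 = s by ring,
      show N - 2 - l - a - (s - 1 - a) = N + (-1 - l - s) by ring]
  · refine hasFiniteSupport_of_bounds (s - 1 - M) M fun a ha => ?_
    rw [hM _ _ _ (by omega)]

/-! ### Truncation conditions and linearity of residues. -/

section Residue

variable {M M' : Type*} [AddCommGroup M] [AddCommGroup M']

/-- Vanishing of the modes with large second index. -/
def RightBounded (f : ℤ → ℤ → M) : Prop := ∃ B : ℤ, ∀ m n, B ≤ n → f m n = 0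

/-- Vanishing of the modes with large first index. -/
def LeftBounded (f : ℤ → ℤ → M) : Prop := ∃ B : ℤ, ∀ m, B ≤ m → ∀ n, f m n = 0

theorem RightBounded.hasFiniteSupport {f : ℤ → ℤ → M} (hf : RightBounded f) (k N : ℤ) :
    Function.HasFiniteSupport fun s => outerCoeff k s • f s (N + (k - s)) := by
  obtain ⟨B, hB⟩ := hf
  simpa [add_sub_assoc] using hasFiniteSupport_outer k (N + k) 0 hB

theorem LeftBounded.hasFiniteSupport {f : ℤ → ℤ → M} (hf : LeftBounded f) (k N : ℤ) :
    Function.HasFiniteSupport fun s => innerCoeff k s • f s (N + (k - s)) := by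
  obtain ⟨B, hB⟩ := hf
  simpa [add_sub_assoc] using hasFiniteSupport_inner k (N + k) 0 hB

variable {c : ℤ → ℤ} {k N : ℤ} {f g : ℤ → ℤ → M}

theorem residue_sub (hf : Function.HasFiniteSupport fun s => c s • f s (N + (k - s)))
    (hg : Function.HasFiniteSupport fun s => c s • g s (N + (k - s))) :
    residue c k (fun s n => f s n - g s n) N = residue c k f N - residue c k g N := by
  simp only [residue, smul_sub]
  exact finsum_sub_distrib hf hg

theorem residue_map (φ : M →+ M')
    (hf : Function.HasFiniteSupport fun s => c s • f s (N + (k - s))) :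
    residue c k (fun s n => φ (f s n)) N = φ (residue c k f N) := by
  simp only [residue, map_finsum φ hf, map_zsmul]

theorem residue_shift (m : ℤ) :
    residue c k (fun s n => f s (m + n)) N = residue c k f (m + N) :=
  finsum_congr fun s => by rw [add_assoc]

/-- Shaped for the Wick formula: one undisturbed term, then a simple-pole and a double-pole term for
each of the two contractions. -/
theorem residue_wick {f₀ f₁ f₂ f₃ f₄ : ℤ → ℤ → M} (m : ℤ)
    (h₀ : Function.HasFiniteSupport fun s => c s • f₀ s (N + (k - s)))
    (h₁ : Function.HasFiniteSupport fun s => c s • f₁ s (N + (k - s)))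
    (h₂ : Function.HasFiniteSupport fun s => c s • f₂ s (N + (k - s)))
    (h₃ : Function.HasFiniteSupport fun s => c s • f₃ s (N + (k - s)))
    (h₄ : Function.HasFiniteSupport fun s => c s • f₄ s (N + (k - s))) :
    residue c k (fun s n => f₀ s n + (f₁ s n + m • f₂ s n + (f₃ s n + m • f₄ s n))) N =
      residue c k f₀ N + (residue c k f₁ N + m • residue c k f₂ N +
        (residue c k f₃ N + m • residue c k f₄ N)) := by
  have h₂' := h₂.smul_right fun _ => m
  have h₄' := h₄.smul_right fun _ => m
  simp only [residue, smul_add, smul_finsum' m h₂, smul_finsum' m h₄, smul_comm _ m]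
  exact (finsum_add_distrib h₀ ((h₁.add h₂').add (h₃.add h₄'))).trans (congrArg _
    ((finsum_add_distrib (h₁.add h₂') (h₃.add h₄')).trans
      (congrArg₂ _ (finsum_add_distrib h₁ h₂') (finsum_add_distrib h₃ h₄'))))

theorem residue_outer_zero (f : ℤ → ℤ → M) (N : ℤ) : residue (outerCoeff 0) 0 f N = f 0 N := by
  rw [residue, finsum_eq_single _ 0 (fun s hs => by simp [outerCoeff_zero, hs])]
  simp [outerCoeff_zero]

theorem residue_inner_zero (f : ℤ → ℤ → M) (N : ℤ) : residue (innerCoeff 0) 0 f N = f 0 N := by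
  rw [residue, finsum_eq_single _ 0 (fun s hs => by simp [innerCoeff_zero, hs])]
  simp [innerCoeff_zero]

end Residue

/-! ### Expansions with poles of order at most two, and the Wick formula. -/

variable {D E D₁ D₂ E₁ E₂ G : VertexOperator ℂ V}

theorem rightBounded_mul (Φ : ℤ → Module.End ℂ V) (C : VertexOperator ℂ V) (a : ℤ) (v : V) :
    RightBounded fun s n => Φ s (ncoeff C (a + n) v) := by
  obtain ⟨M, hM⟩ := exists_ncoeff_eq_zero C v
  exact ⟨M - a, fun s n hn => by simp [hM (a + n) (by omega)]⟩

theorem leftBounded_mul (Φ : ℤ → Module.End ℂ V) (C : VertexOperator ℂ V) (a : ℤ) (v : V) :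
    LeftBounded fun s n => Φ n (ncoeff C (a + s) v) := by
  obtain ⟨M, hM⟩ := exists_ncoeff_eq_zero C v
  exact ⟨M - a, fun s hs n => by simp [hM (a + s) (by omega)]⟩

theorem prod_smul_left (c : ℂ) (p : ℤ) : prod p (c • A) B = c • prod p A B := by
  refine field_ext fun N v => ?_
  simp only [map_smul, Pi.smul_apply, LinearMap.smul_apply, ncoeff_prod, residue, smul_sub,
    smul_finsum, smul_comm c]

theorem prod_smul_right (c : ℂ) (p : ℤ) : prod p A (c • B) = c • prod p A B := by
  refine field_ext fun N v => ?_
  simp only [map_smul, Pi.smul_apply, LinearMap.smul_apply, ncoeff_prod, residue, smul_sub,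
    smul_finsum, smul_comm c]

theorem prod_neg_left (p : ℤ) : prod p (-A) B = -prod p A B := by
  refine field_ext fun N v => ?_
  simp only [map_neg, Pi.neg_apply, LinearMap.neg_apply, ncoeff_prod, residue, smul_neg,
    finsum_neg_distrib]
  abel

theorem prod_neg_right (p : ℤ) : prod p A (-B) = -prod p A B := by
  refine field_ext fun N v => ?_
  simp only [map_neg, Pi.neg_apply, LinearMap.neg_apply, ncoeff_prod, residue, smul_neg,
    finsum_neg_distrib]
  abel

theorem prod_zero_field (p : ℤ) : prod p 0 B = 0 := by
  refine field_ext fun N v => ?_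
  simp [ncoeff_prod, residue]

theorem prod_field_zero (p : ℤ) : prod p A (0 : VertexOperator ℂ V) = 0 := by
  refine field_ext fun N v => ?_
  simp [ncoeff_prod, residue]

theorem ncoeff_idField (n : ℤ) (v : V) : ncoeff idField n v = if n = -1 then v else 0 := by
  rw [idField, ncoeff_ofModes]
  split_ifs <;> simp

theorem isLocal_idField : IsLocal 0 idField A := by
  refine isLocal_zero_iff.mpr fun m n v => ?_
  rw [ncoeff_idField, ncoeff_idField]
  split_ifs <;> simp

theorem idField_prod : prod 0 idField A = A := by
  refine field_ext fun N v => ?_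
  rw [ncoeff_prod_zero isLocal_idField, finsum_eq_single _ (-1)]
  · rw [ncoeff_idField, if_pos rfl, show N - 1 - -1 = N by ring]
  · intro s hs
    rw [ncoeff_idField, if_neg hs]

theorem prod_idField : prod 0 A idField = A := by
  refine field_ext fun N v => ?_
  rw [ncoeff_prod_zero isLocal_idField.symm, finsum_eq_single _ N]
  · rw [ncoeff_idField, if_pos (by ring)]
  · intro s hs
    rw [ncoeff_idField, if_neg (by omega), map_zero]

/-- The operator product expansion `A(z) B(w) ∼ D(w) / (z - w) + E(w) / (z - w) ^ 2`. -/
def HasOPE (A B D E : VertexOperator ℂ V) : Prop :=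
  ∀ m n : ℤ, ncoeff A m * ncoeff B n - ncoeff B n * ncoeff A m =
    ncoeff D (m + n) + m • ncoeff E (m + n - 1)

theorem HasOPE.congr {D' E' : VertexOperator ℂ V} (h : HasOPE A B D E) (hD : D = D')
    (hE : E = E') : HasOPE A B D' E' := hD ▸ hE ▸ h

theorem SimplePoleOPE.hasOPE (h : SimplePoleOPE A B D) : HasOPE A B D 0 := fun m n => by
  simp [h m n]

theorem HasOPE.simplePole (h : HasOPE A B D 0) : SimplePoleOPE A B D := fun m n => by
  simp [h m n]

theorem HasOPE.isLocal_zero (h : HasOPE A B 0 0) : IsLocal 0 A B :=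
  funext₂ fun m n => (h m n).trans (by simp)

theorem IsLocal.hasOPE (h : IsLocal 0 A B) : HasOPE A B 0 0 := fun m n => by
  rw [h.ncoeff_mul_comm]
  simp

theorem HasOPE.isLocal_one (h : HasOPE A B D 0) : IsLocal 1 A B := by
  ext m n : 2
  simp only [Function.iterate_one, diff, h.simplePole _ _]
  rw [add_right_comm, ← add_assoc, sub_self]
  rfl

theorem HasOPE.add_right (h₁ : HasOPE A B D₁ E₁) (h₂ : HasOPE A C D₂ E₂) :
    HasOPE A (B + C) (D₁ + D₂) (E₁ + E₂) := fun m n => by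
  have e₁ := h₁ m n
  have e₂ := h₂ m n
  simp only [map_add, Pi.add_apply, mul_add, add_mul, smul_add]
  rw [add_add_add_comm (ncoeff D₁ _), ← e₁, ← e₂]
  abel

theorem HasOPE.smul_right (h : HasOPE A B D E) (c : ℂ) : HasOPE A (c • B) (c • D) (c • E) :=
  fun m n => by
    simp only [map_smul, Pi.smul_apply, mul_smul_comm, smul_mul_assoc, smul_comm m c]
    rw [← smul_sub, h m n, smul_add]

theorem HasOPE.neg_right (h : HasOPE A B D E) : HasOPE A (-B) (-D) (-E) := fun m n => by
  simp only [map_neg, Pi.neg_apply, mul_neg, neg_mul, smul_neg]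
  rw [← neg_add, ← h m n]
  abel

theorem HasOPE.symm (h : HasOPE A B D 0) : HasOPE B A (-D) 0 := fun m n => by
  rw [← neg_sub, h n m, add_comm n m]
  simp

/-- Reversing an expansion whose double pole is a multiple of the identity. -/
theorem HasOPE.symm_of_smul_id {c : ℂ} (h : HasOPE A B D (c • idField)) :
    HasOPE B A (-D) (c • idField) := fun m n => by
  rw [← neg_sub, h n m, neg_add]
  ext v
  simp only [map_neg, map_smul, Pi.neg_apply, Pi.smul_apply, LinearMap.add_apply,
    LinearMap.neg_apply, LinearMap.smul_apply, ncoeff_idField, add_comm n m]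
  split_ifs with hmn
  · rw [show n = -m by omega, neg_smul, neg_neg]
  · simp

/-- The residue defining $(DC)_0$ with an extra power of $z$ on $D$; replacing that power by one of
$w$ costs a multiple of the simple pole $G$. -/
theorem residue_shift_left (hG : HasOPE D C G 0) (a N : ℤ) (v : V) :
    residue (outerCoeff (-1)) (-1) (fun s n => ncoeff D (a + s) (ncoeff C n v)) N -
      residue (innerCoeff (-1)) (-1) (fun s n => ncoeff C n (ncoeff D (a + s) v)) N =
    ncoeff (prod 0 D C) (a + N) v + a • ncoeff G (a + N - 1) v := by
  set σ : ℤ → ℤ → V := fun a N =>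
    residue (outerCoeff (-1)) (-1) (fun s n => ncoeff D (a + s) (ncoeff C n v)) N -
      residue (innerCoeff (-1)) (-1) (fun s n => ncoeff C n (ncoeff D (a + s) v)) N with hσ
  have hbound1 (a b : ℤ) : RightBounded fun s n => ncoeff D (a + s) (ncoeff C (b + n) v) :=
    rightBounded_mul _ C b v
  have hbound2 (a b : ℤ) : LeftBounded fun s n => ncoeff C (b + n) (ncoeff D (a + s) v) :=
    leftBounded_mul (fun n => ncoeff C (b + n)) D a v
  -- The difference of $z^{a+1}$ and $z^aw$ is $z^a(z-w)$, which cancels $(z-w)^{-1}$ and leaves a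
  -- commutator of modes.
  have hstep (a N : ℤ) : σ (a + 1) N = σ a (N + 1) + ncoeff G (a + N) v := by
    have h1 := residue_sub (f := fun s n => ncoeff D (a + 1 + s) (ncoeff C (0 + n) v))
      (g := fun s n => ncoeff D (a + s) (ncoeff C (1 + n) v))
      ((hbound1 (a + 1) 0).hasFiniteSupport (-1) N)
      ((hbound1 a 1).hasFiniteSupport (-1) N)
    have h2 := residue_sub (f := fun s n => ncoeff C (0 + n) (ncoeff D (a + 1 + s) v))
      (g := fun s n => ncoeff C (1 + n) (ncoeff D (a + s) v))
      ((hbound2 (a + 1) 0).hasFiniteSupport (-1) N)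
      ((hbound2 a 1).hasFiniteSupport (-1) N)
    rw [residue_shift (f := fun s n => ncoeff D (a + s) (ncoeff C n v))] at h1
    rw [residue_shift (f := fun s n => ncoeff C n (ncoeff D (a + s) v))] at h2
    obtain ⟨B₁, hB₁⟩ := hbound1 a 0
    obtain ⟨B₂, hB₂⟩ := hbound2 a 0
    simp only [zero_add] at h1 h2 hB₁ hB₂
    have h3 := residue_outer_iterate_diff 1 (-1) hB₁ N
    have h4 := residue_inner_iterate_diff 1 (-1) hB₂ N
    rw [show (-1 : ℤ) + (1 : ℕ) = 0 by norm_num, Function.iterate_one] at h3 h4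
    rw [residue_outer_zero] at h3
    rw [residue_inner_zero] at h4
    have e1 : diff (fun s n => ncoeff D (a + s) (ncoeff C n v)) = fun s n =>
        ncoeff D (a + 1 + s) (ncoeff C n v) - ncoeff D (a + s) (ncoeff C (1 + n) v) := by
      ext s n
      rw [diff, add_comm n 1, add_assoc a 1 s, add_comm 1 s]
    have e2 : diff (fun s n => ncoeff C n (ncoeff D (a + s) v)) = fun s n =>
        ncoeff C n (ncoeff D (a + 1 + s) v) - ncoeff C (1 + n) (ncoeff D (a + s) v) := by
      ext s n
      rw [diff, add_comm n 1, add_assoc a 1 s, add_comm 1 s]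
    rw [← e1, h3, add_zero] at h1
    rw [← e2, h4, add_zero] at h2
    have h5 : ncoeff D a (ncoeff C N v) - ncoeff C N (ncoeff D a v) = ncoeff G (a + N) v :=
      LinearMap.congr_fun (hG.simplePole a N) v
    rw [h1, h2] at h5
    simp only [hσ]
    rw [← h5, add_comm N 1]
    abel
  have hzero (N : ℤ) : σ 0 N = ncoeff (prod 0 D C) N v := by
    simp only [hσ, zero_add]
    rw [ncoeff_prod]
    rfl
  change σ a N = _
  induction a generalizing N with
  | zero => simp [hzero]
  | succ a ih =>
    rw [hstep, ih, show (a : ℤ) + (N + 1) = a + 1 + N by ring,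
      show (a : ℤ) + 1 + N - 1 = a + N by ring, add_smul, one_smul, add_assoc]
  | pred a ih =>
    have := hstep (-a - 1) (N - 1)
    rw [sub_add_cancel, sub_add_cancel, ih] at this
    rw [← sub_eq_iff_eq_add] at this
    rw [← this, show -(a : ℤ) - 1 + N = -a + (N - 1) by ring,
      show -(a : ℤ) - 1 + (N - 1) = -a + (N - 1) - 1 by ring, sub_smul (-(a : ℤ)), one_smul,
      add_sub_assoc]

/-- The Wick formula for a normally ordered product. -/
theorem HasOPE.prod_zero (h₁ : HasOPE A B D₁ E₁) (h₂ : HasOPE A C D₂ E₂) (hG : HasOPE D₁ C G 0)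
    (hE : IsLocal 0 E₁ C) :
    HasOPE A (prod 0 B C) (prod 0 D₁ C + prod 0 B D₂) (G + prod 0 E₁ C + prod 0 B E₂) := by
  intro m n
  refine LinearMap.ext fun v => ?_
  have hBC (a : V) : RightBounded fun s n => ncoeff B s (ncoeff C n a) := by
    simpa using rightBounded_mul (ncoeff B) C 0 a
  have hCB (a : V) : LeftBounded fun s n => ncoeff C n (ncoeff B s a) := by
    simpa using leftBounded_mul (ncoeff C) B 0 a
  have r₁ : RightBounded fun s n => ncoeff D₁ (m + s) (ncoeff C n v) := by
    simpa using rightBounded_mul (fun s => ncoeff D₁ (m + s)) C 0 v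
  have r₂ : RightBounded fun s n => ncoeff E₁ (m - 1 + s) (ncoeff C n v) := by
    simpa using rightBounded_mul (fun s => ncoeff E₁ (m - 1 + s)) C 0 v
  have r₃ : RightBounded fun s n => ncoeff B s (ncoeff D₂ (m + n) v) :=
    rightBounded_mul (ncoeff B) D₂ m v
  have r₄ : RightBounded fun s n => ncoeff B s (ncoeff E₂ (m - 1 + n) v) :=
    rightBounded_mul (ncoeff B) E₂ (m - 1) v
  have l₁ : LeftBounded fun s n => ncoeff C n (ncoeff D₁ (m + s) v) :=
    leftBounded_mul (ncoeff C) D₁ m v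
  have l₂ : LeftBounded fun s n => ncoeff C n (ncoeff E₁ (m - 1 + s) v) :=
    leftBounded_mul (ncoeff C) E₁ (m - 1) v
  have l₃ : LeftBounded fun s n => ncoeff D₂ (m + n) (ncoeff B s v) := by
    simpa using leftBounded_mul (fun n => ncoeff D₂ (m + n)) B 0 v
  have l₄ : LeftBounded fun s n => ncoeff E₂ (m - 1 + n) (ncoeff B s v) := by
    simpa using leftBounded_mul (fun n => ncoeff E₂ (m - 1 + n)) B 0 v
  have c₁ (s : ℤ) (u : V) : ncoeff A m (ncoeff B s u) = ncoeff B s (ncoeff A m u) +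
      (ncoeff D₁ (m + s) u + m • ncoeff E₁ (m - 1 + s) u) := by
    have := LinearMap.congr_fun (h₁ m s) u
    rw [show m + s - 1 = m - 1 + s by ring] at this
    exact sub_eq_iff_eq_add'.mp this
  have c₂ (s : ℤ) (u : V) : ncoeff A m (ncoeff C s u) = ncoeff C s (ncoeff A m u) +
      (ncoeff D₂ (m + s) u + m • ncoeff E₂ (m - 1 + s) u) := by
    have := LinearMap.congr_fun (h₂ m s) u
    rw [show m + s - 1 = m - 1 + s by ring] at this
    exact sub_eq_iff_eq_add'.mp this
  have eL := residue_wick (c := outerCoeff (-1)) (k := -1) (N := n) m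
    (f₀ := fun s n => ncoeff B s (ncoeff C n (ncoeff A m v)))
    (f₁ := fun s n => ncoeff D₁ (m + s) (ncoeff C n v))
    (f₂ := fun s n => ncoeff E₁ (m - 1 + s) (ncoeff C n v))
    (f₃ := fun s n => ncoeff B s (ncoeff D₂ (m + n) v))
    (f₄ := fun s n => ncoeff B s (ncoeff E₂ (m - 1 + n) v))
    ((hBC _).hasFiniteSupport _ _) (r₁.hasFiniteSupport _ _) (r₂.hasFiniteSupport _ _)
    (r₃.hasFiniteSupport _ _) (r₄.hasFiniteSupport _ _)
  rw [residue_shift (f := fun s n => ncoeff B s (ncoeff D₂ n v)),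
    residue_shift (f := fun s n => ncoeff B s (ncoeff E₂ n v))] at eL
  have eR := residue_wick (c := innerCoeff (-1)) (k := -1) (N := n) m
    (f₀ := fun s n => ncoeff C n (ncoeff B s (ncoeff A m v)))
    (f₁ := fun s n => ncoeff C n (ncoeff D₁ (m + s) v))
    (f₂ := fun s n => ncoeff C n (ncoeff E₁ (m - 1 + s) v))
    (f₃ := fun s n => ncoeff D₂ (m + n) (ncoeff B s v))
    (f₄ := fun s n => ncoeff E₂ (m - 1 + n) (ncoeff B s v))
    ((hCB _).hasFiniteSupport _ _) (l₁.hasFiniteSupport _ _) (l₂.hasFiniteSupport _ _)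
    (l₃.hasFiniteSupport _ _) (l₄.hasFiniteSupport _ _)
  rw [residue_shift (f := fun s n => ncoeff D₂ n (ncoeff B s v)),
    residue_shift (f := fun s n => ncoeff E₂ n (ncoeff B s v))] at eR
  have fL : (fun s n => ncoeff A m (ncoeff B s (ncoeff C n v))) = fun s n =>
      ncoeff B s (ncoeff C n (ncoeff A m v)) + (ncoeff D₁ (m + s) (ncoeff C n v) +
        m • ncoeff E₁ (m - 1 + s) (ncoeff C n v) + (ncoeff B s (ncoeff D₂ (m + n) v) +
        m • ncoeff B s (ncoeff E₂ (m - 1 + n) v))) := by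
    ext s n
    rw [c₁, c₂, map_add, map_add, map_zsmul]
    abel
  have fR : (fun s n => ncoeff A m (ncoeff C n (ncoeff B s v))) = fun s n =>
      ncoeff C n (ncoeff B s (ncoeff A m v)) + (ncoeff C n (ncoeff D₁ (m + s) v) +
        m • ncoeff C n (ncoeff E₁ (m - 1 + s) v) + (ncoeff D₂ (m + n) (ncoeff B s v) +
        m • ncoeff E₂ (m - 1 + n) (ncoeff B s v))) := by
    ext s n
    rw [c₂, c₁, map_add, map_add, map_zsmul]
    abel
  rw [← fL] at eL
  rw [← fR] at eR
  replace eL := (residue_map (ncoeff A m).toAddMonoidHom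
    ((hBC v).hasFiniteSupport (-1) n)).symm.trans eL
  replace eR := (residue_map (ncoeff A m).toAddMonoidHom
    ((hCB v).hasFiniteSupport (-1) n)).symm.trans eR
  rw [LinearMap.toAddMonoidHom_coe] at eL eR
  -- The contraction with $B$ shifts the modes of `D₁` and `E₁`. Undoing the shift of `D₁` creates
  -- the double pole `G`; for `E₁` there is no correction, hence no triple pole.
  have s₁ := residue_shift_left hG m n v
  have s₂ := residue_shift_left hE.hasOPE (m - 1) n v
  have p₁ := ncoeff_prod 0 B C n v
  have p₂ := ncoeff_prod 0 B C n (ncoeff A m v)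
  have p₃ := ncoeff_prod 0 B D₂ (m + n) v
  have p₄ := ncoeff_prod 0 B E₂ (m - 1 + n) v
  rw [zero_sub] at p₁ p₂ p₃ p₄
  have q₁ := congrArg (ncoeff A m) p₁
  rw [map_sub, eL, eR] at q₁
  have e : m + n - 1 = m - 1 + n := by ring
  simp only [map_zero, Pi.zero_apply, LinearMap.zero_apply, smul_zero, add_zero] at s₂
  simp only [LinearMap.sub_apply, Module.End.mul_apply, map_add, Pi.add_apply, LinearMap.add_apply,
    LinearMap.smul_apply, smul_add]
  rw [q₁, p₂, p₃, e, p₄, ← s₂, smul_sub, smul_sub]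
  rw [e] at s₁
  rw [← sub_eq_iff_eq_add] at s₁
  rw [← s₁]
  abel

/-- The mode $D_k$ equals both $[A_k,A_0]$ and $[A_0,A_k]$, so $2D_k=0$. -/
theorem HasOPE.isLocal_zero_of_self (h : HasOPE A A D 0) : IsLocal 0 A A := by
  have hD (k : ℤ) : ncoeff D k = 0 := by
    have h1 := h.simplePole k 0
    have h2 := h.simplePole 0 k
    rw [add_zero] at h1
    rw [zero_add] at h2
    have h3 : (2 : ℂ) • ncoeff D k = 0 := by
      rw [two_smul]
      nth_rewrite 1 [← h1]
      rw [← h2]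
      abel
    exact (smul_eq_zero.mp h3).resolve_left two_ne_zero
  exact funext₂ fun m n => (h.simplePole m n).trans (hD _)

theorem HasOPE.neg_left (h : HasOPE A B D E) : HasOPE (-A) B (-D) (-E) := fun m n => by
  simp only [map_neg, Pi.neg_apply, mul_neg, neg_mul, smul_neg]
  rw [← neg_add, ← h m n]
  abel

theorem isLocal_zero_field : IsLocal 0 0 A := by
  refine isLocal_zero_iff.mpr fun m n v => ?_
  simp

theorem IsLocal.smul_left (h : IsLocal 0 A B) (c : ℂ) : IsLocal 0 (c • A) B := by
  refine isLocal_zero_iff.mpr fun m n v => ?_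
  simp [isLocal_zero_iff.mp h]

theorem IsLocal.add_right (h : IsLocal 0 A B) (h' : IsLocal 0 A C) : IsLocal 0 A (B + C) := by
  refine isLocal_zero_iff.mpr fun m n v => ?_
  simp [isLocal_zero_iff.mp h, isLocal_zero_iff.mp h']

theorem IsLocal.smul_right (h : IsLocal 0 A B) (c : ℂ) : IsLocal 0 A (c • B) :=
  (h.symm.smul_left c).symm

theorem IsLocal.neg_right (h : IsLocal 0 A B) : IsLocal 0 A (-B) := by
  refine isLocal_zero_iff.mpr fun m n v => ?_
  simp [isLocal_zero_iff.mp h]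

/-- The Wick formula when all expansions involved have simple poles only. -/
theorem HasOPE.prod_zero_of_isLocal (h₁ : HasOPE A B D₁ 0)
    (h₂ : HasOPE A C D₂ 0) (h : IsLocal 0 D₁ C) :
    HasOPE A (prod 0 B C) (prod 0 D₁ C + prod 0 B D₂) 0 :=
  (h₁.prod_zero h₂ h.hasOPE isLocal_zero_field).congr rfl (by
    rw [prod_zero_field, prod_field_zero, add_zero, add_zero])

/-! ### Expansions of the fields $X_i$, $Y_i$, $D_iX_i$. -/

namespace SymplecticBosons

variable {ι : Type*} [DecidableEq ι] (S : SymplecticBosons ι V) (i : ι)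

theorem hasOPE_X_X : HasOPE (S.X i) (S.X i) 0 0 := (S.ope_XX i i).hasOPE

theorem hasOPE_X_Y : HasOPE (S.X i) (S.Y i) idField 0 := by
  have h := (S.ope_XY i i).hasOPE
  rwa [if_pos rfl] at h

theorem hasOPE_Y_X : HasOPE (S.Y i) (S.X i) (-idField) 0 := (S.hasOPE_X_Y i).symm

theorem hasOPE_Y_Y : HasOPE (S.Y i) (S.Y i) 0 0 := (S.ope_YY i i).hasOPE

theorem isLocal_X_X : IsLocal 0 (S.X i) (S.X i) := (S.hasOPE_X_X i).isLocal_zero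

theorem isLocal_neg_idField {A : VertexOperator ℂ V} : IsLocal 0 (-idField) A :=
  isLocal_idField.symm.neg_right.symm

theorem hasOPE_X_gauge : HasOPE (S.X i) (S.gauge i) (-S.X i) 0 :=
  ((S.hasOPE_X_X i).prod_zero_of_isLocal
    (S.hasOPE_X_Y i) isLocal_zero_field).neg_right.congr
    (by rw [prod_idField, prod_zero_field, zero_add]) neg_zero

theorem hasOPE_X_YX : HasOPE (S.X i) (prod 0 (S.Y i) (S.X i)) (S.X i) 0 :=
  ((S.hasOPE_X_Y i).prod_zero_of_isLocal (S.hasOPE_X_X i) isLocal_idField).congr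
    (by rw [idField_prod, prod_field_zero, add_zero]) rfl

theorem hasOPE_Y_gauge : HasOPE (S.Y i) (S.gauge i) (S.Y i) 0 :=
  ((S.hasOPE_Y_X i).prod_zero_of_isLocal
    (S.hasOPE_Y_Y i) isLocal_neg_idField).neg_right.congr
    (by rw [prod_neg_left, idField_prod, prod_field_zero, add_zero, neg_neg]) neg_zero

theorem hasOPE_Y_YX : HasOPE (S.Y i) (prod 0 (S.Y i) (S.X i)) (-S.Y i) 0 :=
  ((S.hasOPE_Y_Y i).prod_zero_of_isLocal (S.hasOPE_Y_X i) isLocal_zero_field).congr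
    (by rw [prod_neg_right, prod_idField, prod_zero_field, zero_add]) rfl

theorem hasOPE_covD {A D D' E E' : VertexOperator ℂ V}
    (h : HasOPE A (prod 0 (S.gauge i) (S.X i)) D E)
    (h' : HasOPE A (prod 0 (S.X i) (prod 0 (S.Y i) (S.X i))) D' E') :
    HasOPE A (S.covD i (S.X i)) (D + D' + D) (E + E' + E) :=
  ((h.add_right h').add_right (h.smul_right 1)).congr (by rw [one_smul]) (by rw [one_smul])

/-- The two copies of $(\mathcal A_iX_i)_0$ contribute $-(X_iX_i)_0$ each, the remaining summand
$+(X_iX_i)_0$. -/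
theorem hasOPE_X_covD : HasOPE (S.X i) (S.covD i (S.X i)) (-prod 0 (S.X i) (S.X i)) 0 := by
  have h₁ := (S.hasOPE_X_gauge i).prod_zero_of_isLocal (S.hasOPE_X_X i)
    (S.isLocal_X_X i).neg_right.symm
  have h₂ := (S.hasOPE_X_X i).prod_zero_of_isLocal (S.hasOPE_X_YX i) isLocal_zero_field
  refine (S.hasOPE_covD i h₁ h₂).congr ?_ (by simp)
  rw [prod_neg_left, prod_zero_field, prod_field_zero]
  abel

theorem hasOPE_covD_X : HasOPE (S.covD i (S.X i)) (S.X i) (prod 0 (S.X i) (S.X i)) 0 :=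
  (S.hasOPE_X_covD i).symm.congr (neg_neg _) rfl

/-- The double pole comes from contracting $Y_i$ twice with $(\mathcal A_iX_i)_0$, once for each of
its two copies. -/
theorem hasOPE_Y_covD : HasOPE (S.Y i) (S.covD i (S.X i))
    (prod 0 (S.Y i) (S.X i) - S.gauge i) ((-2 : ℂ) • idField) := by
  have h₁ := (S.hasOPE_Y_gauge i).prod_zero (S.hasOPE_Y_X i) (S.hasOPE_Y_X i)
    isLocal_zero_field
  have h₂ := (S.hasOPE_Y_X i).prod_zero_of_isLocal (S.hasOPE_Y_YX i) isLocal_neg_idField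
  refine (S.hasOPE_covD i h₁ h₂).congr ?_ ?_
  · rw [prod_neg_right, prod_neg_right, prod_neg_left, idField_prod, prod_idField]
    simp only [gauge]
    abel
  · rw [prod_zero_field, prod_field_zero]
    module

theorem hasOPE_covD_Y : HasOPE (S.covD i (S.X i)) (S.Y i)
    (-(prod 0 (S.Y i) (S.X i) - S.gauge i)) ((-2 : ℂ) • idField) :=
  (S.hasOPE_Y_covD i).symm_of_smul_id

theorem hasOPE_XX_Y : HasOPE (prod 0 (S.X i) (S.X i)) (S.Y i) ((2 : ℂ) • S.X i) 0 := by
  have h := (S.hasOPE_Y_X i).prod_zero_of_isLocal (S.hasOPE_Y_X i) isLocal_neg_idField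
  refine h.symm.congr ?_ rfl
  rw [prod_neg_left, prod_neg_right, idField_prod, prod_idField]
  module

theorem hasOPE_X_neutral : HasOPE (S.X i) (prod 0 (S.Y i) (S.X i) - S.gauge i)
    ((2 : ℂ) • S.X i) 0 := by
  rw [sub_eq_add_neg]
  exact ((S.hasOPE_X_YX i).add_right (S.hasOPE_X_gauge i).neg_right).congr
    (by rw [neg_neg, two_smul]) (by rw [neg_zero, add_zero])

theorem hasOPE_neutral_X : HasOPE (-(prod 0 (S.Y i) (S.X i) - S.gauge i)) (S.X i)
    ((2 : ℂ) • S.X i) 0 :=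
  (S.hasOPE_X_neutral i).symm.neg_left.congr (neg_neg _) neg_zero

/-- The coefficient of the simple pole of `D_i X_i` with the gauge current. -/
def gaugePole : VertexOperator ℂ V :=
  -(prod 0 (prod 0 (S.X i) (S.X i)) (S.Y i) +
    prod 0 (S.X i) (-(prod 0 (S.Y i) (S.X i) - S.gauge i)))

/-- The double pole $-2X_i$ of $D_iX_i$ with $Y_i$, multiplied by $X_i$'s partner in the current, is
cancelled by the iterated contraction $+2X_i$. -/
theorem hasOPE_covD_gauge : HasOPE (S.covD i (S.X i)) (S.gauge i) (S.gaugePole i) 0 := by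
  have h := (S.hasOPE_covD_X i).prod_zero (S.hasOPE_covD_Y i) (S.hasOPE_XX_Y i)
    isLocal_zero_field
  refine h.neg_right.congr rfl ?_
  rw [prod_zero_field, prod_smul_right, prod_idField]
  module

theorem hasOPE_gaugePole_X :
    HasOPE (S.gaugePole i) (S.X i) (-prod 0 (S.X i) (S.X i)) 0 := by
  have hXX := (S.hasOPE_X_X i).prod_zero_of_isLocal (S.hasOPE_X_X i) isLocal_zero_field
  have h₁ := hXX.prod_zero_of_isLocal (S.hasOPE_X_Y i)
    (by rw [prod_zero_field, prod_field_zero, add_zero]; exact isLocal_zero_field)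
  have h₂ := (S.hasOPE_X_X i).prod_zero_of_isLocal
    ((S.hasOPE_X_neutral i).neg_right.congr rfl neg_zero) isLocal_zero_field
  refine ((h₁.add_right h₂).neg_right.congr rfl (by rw [add_zero, neg_zero])).symm.congr ?_ rfl
  rw [prod_zero_field 0 (B := S.X i), prod_field_zero, add_zero, prod_zero_field, prod_zero_field,
    prod_idField, prod_neg_right, prod_smul_right]
  module

theorem hasOPE_covD_YX : ∃ D, HasOPE (S.covD i (S.X i)) (prod 0 (S.Y i) (S.X i)) D 0 := by
  have h := (S.hasOPE_covD_Y i).prod_zero (S.hasOPE_covD_X i) (S.hasOPE_neutral_X i)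
    (isLocal_idField.smul_left _)
  refine ⟨_, h.congr rfl ?_⟩
  rw [prod_field_zero, prod_smul_left, idField_prod]
  module

theorem hasOPE_XX_YX : HasOPE (prod 0 (S.X i) (S.X i)) (prod 0 (S.Y i) (S.X i))
    ((2 : ℂ) • prod 0 (S.X i) (S.X i)) 0 := by
  have h := (S.hasOPE_X_YX i).symm.prod_zero_of_isLocal (S.hasOPE_X_YX i).symm
    (S.isLocal_X_X i).neg_right.symm
  refine h.symm.congr ?_ rfl
  rw [prod_neg_left, prod_neg_right]
  module

/-- The double poles of the three summands of $D_iX_i$ are $-1$, $2$ and $-1$ times $(X_iX_i)_0$ and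
cancel. The simple pole need not be computed, since antisymmetry kills it. -/
theorem isLocal_covD_covD : IsLocal 0 (S.covD i (S.X i)) (S.covD i (S.X i)) := by
  obtain ⟨D, hD⟩ := S.hasOPE_covD_YX i
  have h₁ := (S.hasOPE_covD_gauge i).prod_zero (S.hasOPE_covD_X i) (S.hasOPE_gaugePole_X i)
    isLocal_zero_field
  have h₂ := (S.hasOPE_covD_X i).prod_zero hD (S.hasOPE_XX_YX i) isLocal_zero_field
  refine HasOPE.isLocal_zero_of_self ((S.hasOPE_covD i h₁ h₂).congr rfl ?_)
  rw [prod_zero_field, prod_zero_field, prod_field_zero, prod_field_zero]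
  module

theorem hasOPE_factor (a b : Kind) : HasOPE (S.factor i a) (S.factor i b) (S.R i a b) 0 := by
  cases a <;> cases b
  · exact S.hasOPE_X_X i
  · exact S.hasOPE_X_covD i
  · exact S.hasOPE_covD_X i
  · exact (S.isLocal_covD_covD i).hasOPE

section Commuting

variable {S i}

theorem isLocal_covD (hX : IsLocal 0 A (S.X i)) (hY : IsLocal 0 A (S.Y i)) :
    IsLocal 0 A (S.covD i (S.X i)) := by
  have hg : IsLocal 0 A (S.gauge i) := (hY.prod_right hX 0).neg_right
  have hgX : IsLocal 0 A (prod 0 (S.gauge i) (S.X i)) := hX.prod_right hg 0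
  exact (hgX.add_right ((hX.prod_right hY 0).prod_right hX 0)).add_right (hgX.smul_right 1)

theorem isLocal_factor (hX : IsLocal 0 A (S.X i)) (hY : IsLocal 0 A (S.Y i)) (a : Kind) :
    IsLocal 0 A (S.factor i a) := by
  cases a
  · exact hX
  · exact isLocal_covD hX hY

theorem isLocal_R (hX : IsLocal 0 A (S.X i)) (a b : Kind) : IsLocal 0 A (S.R i a b) := by
  have hXX := hX.prod_right hX 0
  cases a <;> cases b
  · exact isLocal_zero_field.symm
  · exact hXX.neg_right
  · exact hXX
  · exact isLocal_zero_field.symm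

end Commuting

theorem isLocal_factor_factor {i j : ι} (hij : i ≠ j) (a b : Kind) :
    IsLocal 0 (S.factor i a) (S.factor j b) ∧ ∀ c, IsLocal 0 (S.R i a c) (S.factor j b) := by
  have hXX : IsLocal 0 (S.X i) (S.X j) := (S.ope_XX i j).hasOPE.isLocal_zero
  have hYY : IsLocal 0 (S.Y i) (S.Y j) := (S.ope_YY i j).hasOPE.isLocal_zero
  have hXY : IsLocal 0 (S.X i) (S.Y j) := by
    have := (S.ope_XY i j).hasOPE
    rw [if_neg hij] at this
    exact this.isLocal_zero
  have hYX : IsLocal 0 (S.Y i) (S.X j) := by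
    have := (S.ope_XY j i).hasOPE
    rw [if_neg hij.symm] at this
    exact this.isLocal_zero.symm
  have hX : IsLocal 0 (S.factor j b) (S.X i) := (isLocal_factor hXX hXY b).symm
  have hY : IsLocal 0 (S.factor j b) (S.Y i) := (isLocal_factor hYX hYY b).symm
  exact ⟨(isLocal_factor hX hY a).symm, fun c => (isLocal_R hX a c).symm⟩

end SymplecticBosons

/-! ### Nested products and the recursion. -/

section Nested

variable {N : ℕ}

theorem isLocal_nested {A : VertexOperator ℂ V} {P : Fin N → VertexOperator ℂ V} (n : ℕ)
    (hn : n ≤ N) (h : ∀ j : Fin N, (j : ℕ) < n → IsLocal 0 A (P j)) :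
    IsLocal 0 A (nested P n hn) := by
  induction n using Nat.twoStepInduction with
  | zero => exact isLocal_idField.symm
  | one => exact h _ Nat.zero_lt_one
  | more n _ ih =>
    exact (ih (by omega) fun j hj => h j (by omega)).prod_right (h ⟨n + 1, hn⟩ (by simp)) 0

theorem nested_succ (P : Fin N → VertexOperator ℂ V) {n : ℕ} (hn : 1 ≤ n) (hN : n + 1 ≤ N) :
    nested P (n + 1) hN = prod 0 (P ⟨n, hN⟩) (nested P n (Nat.le_of_succ_le hN)) := by
  obtain ⟨m, rfl⟩ := Nat.exists_eq_add_of_le' hn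
  rfl

/-- The product of two commuting pairs of fields, where the first pair has a simple pole. -/
theorem prod_prod_prod {A B C D R : VertexOperator ℂ V} {K : ℕ} (hAC : HasOPE A C R 0)
    (hBD : IsLocal K B D) (hAB : IsLocal 0 A B) (hAD : IsLocal 0 A D) (hCB : IsLocal 0 C B)
    (hCD : IsLocal 0 C D) (hRB : IsLocal 0 R B) (hRD : IsLocal 0 R D) :
    IsLocal (K + 1) (prod 0 A B) (prod 0 C D) ∧ ∀ l : ℕ,
      prod (K + 1 - l) (prod 0 A B) (prod 0 C D) = prod 0 R (prod (K - l) B D) +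
        ∑ q ∈ Finset.Icc (K + 1 - l : ℤ) K, prod (K + 1 - l - q) A (prod 0 C (prod q B D)) := by
  have hACD : HasOPE A (prod 0 C D) (prod 0 R D) 0 :=
    (hAC.prod_zero_of_isLocal hAD.hasOPE hRD).congr (by rw [prod_field_zero, add_zero]) rfl
  have hBCD : IsLocal K B (prod 0 C D) := hBD.prod_right hCB.symm 0
  have h := IsLocal.prod_zero_left hAB hACD.isLocal_one hBCD
  refine ⟨by rwa [add_comm], fun l => ?_⟩
  -- At `p = 1` the expansion is of $(z-w)^0$, so the product is the commutator with the zero mode,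
  -- that is, the simple pole.
  have hres : prod 1 A (prod 0 C D) = prod 0 R D := by
    refine field_ext fun N v => ?_
    rw [ncoeff_prod, sub_self, residue_outer_zero, residue_inner_zero]
    exact (LinearMap.congr_fun (hACD.simplePole 0 N) v).trans (by rw [zero_add])
  have hlead : prod 1 A (prod (K - l) B (prod 0 C D)) = prod 0 R (prod (K - l) B D) := by
    rw [prod_left_comm hAB hACD.isLocal_one hBCD, hres, prod_left_comm hRB hRD hBD]
  have hsum := prod_prod_zero_left hAB hACD.isLocal_one hBCD l
  -- Separates the term where the product with `A` has index 1; it becomes the `R` term by `hlead`.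
  rw [Finset.Nat.sum_antidiagonal_eq_sum_range_succ_mk, Finset.sum_range_succ'] at hsum
  rw [show (K : ℤ) + 1 - l = ((1 : ℕ) : ℤ) + K - l by push_cast; ring, hsum]
  refine (add_comm _ _).trans (congrArg₂ (· + ·) ?_ ?_)
  · rw [← hlead]
    simp
  -- The index `q` is that of the inner product of `B` and `D`; the shift by one reflects the
  -- separated term.
  · refine Finset.sum_bij' (fun i _ => (K : ℤ) - l + (i + 1)) (fun q _ => (q - K + l - 1).toNat)
      ?_ ?_ ?_ ?_ ?_
    · intro i hi
      rw [Finset.mem_range] at hi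
      rw [Finset.mem_Icc]
      omega
    · intro q hq
      rw [Finset.mem_Icc] at hq
      rw [Finset.mem_range]
      omega
    · intro i hi
      omega
    · intro q hq
      rw [Finset.mem_Icc] at hq
      omega
    · intro i hi
      rw [Finset.mem_range] at hi
      rw [prod_left_comm hCB hCD hBD]
      congr 1
      · push_cast
        ring
      · congr 1
        push_cast [show i + 1 ≤ l by omega]
        ring

end Nested

namespace SymplecticBosons

variable {N : ℕ} (S : SymplecticBosons (Fin N) V)
  (a b : Fin N → Kind) {P Q : Fin N → VertexOperator ℂ V}

theorem nested_step (hP : ∀ i, P i = S.factor i (a i)) (hQ : ∀ i, Q i = S.factor i (b i))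
    {n : ℕ} (hn : 1 ≤ n) (hN : n + 1 ≤ N)
    (h : IsLocal n (nested P n (Nat.le_of_succ_le hN)) (nested Q n (Nat.le_of_succ_le hN))) :
    IsLocal (n + 1) (nested P (n + 1) hN) (nested Q (n + 1) hN) ∧ ∀ l : ℕ,
      prod (n + 1 - l) (nested P (n + 1) hN) (nested Q (n + 1) hN) =
        prod 0 (S.R ⟨n, hN⟩ (a ⟨n, hN⟩) (b ⟨n, hN⟩))
            (prod (n - l) (nested P n (Nat.le_of_succ_le hN))
              (nested Q n (Nat.le_of_succ_le hN))) +
          ∑ q ∈ Finset.Icc (n + 1 - l : ℤ) n, prod (n + 1 - l - q) (P ⟨n, hN⟩)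
            (prod 0 (Q ⟨n, hN⟩) (prod q (nested P n (Nat.le_of_succ_le hN))
              (nested Q n (Nat.le_of_succ_le hN)))) := by
  have hne (j : Fin N) (hj : (j : ℕ) < n) : (⟨n, hN⟩ : Fin N) ≠ j := by
    rintro rfl
    exact lt_irrefl _ hj
  rw [nested_succ P hn, nested_succ Q hn]
  refine prod_prod_prod ?_ h ?_ ?_ ?_ ?_ ?_ ?_
  · rw [hP, hQ]
    exact S.hasOPE_factor _ _ _
  all_goals
    refine isLocal_nested n _ fun j hj => ?_
    simp only [hP, hQ]
  · exact (S.isLocal_factor_factor (hne j hj) _ _).1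
  · exact (S.isLocal_factor_factor (hne j hj) _ _).1
  · exact (S.isLocal_factor_factor (hne j hj) _ _).1
  · exact (S.isLocal_factor_factor (hne j hj) _ _).1
  · exact (S.isLocal_factor_factor (hne j hj) _ _).2 _
  · exact (S.isLocal_factor_factor (hne j hj) _ _).2 _

theorem isLocal_nested_nested (hP : ∀ i, P i = S.factor i (a i))
    (hQ : ∀ i, Q i = S.factor i (b i)) {n : ℕ} (hn : 1 ≤ n) (hN : n ≤ N) :
    IsLocal n (nested P n hN) (nested Q n hN) := by
  induction n, hn using Nat.le_induction with
  | base =>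
    change IsLocal 1 (P ⟨0, hN⟩) (Q ⟨0, hN⟩)
    rw [hP, hQ]
    exact (S.hasOPE_factor _ _ _).isLocal_one
  | succ n hn ih => exact (S.nested_step a b hP hQ hn hN (ih (Nat.le_of_succ_le hN))).1

theorem R_self (i : Fin N) (k : Kind) : S.R i k k = 0 := by
  cases k <;> rfl

end SymplecticBosons

end SymplecticBoson

end

open SymplecticBoson in
theorem theorem1 {V : Type*} [AddCommGroup V] [Module ℂ V] {N : ℕ}
    (S : SymplecticBosons (Fin N) V) (a b : Fin N → Kind)
    (n : ℕ) (hn : 1 ≤ n) (hN : n + 1 ≤ N) (p : ℤ)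
    (P Q : Fin N → VertexOperator ℂ V)
    (hP : ∀ i, P i = S.factor i (a i)) (hQ : ∀ i, Q i = S.factor i (b i)) :
    (p ≤ n →
      prod p (nested P (n + 1) hN) (nested Q (n + 1) hN) =
        prod 0 (S.R ⟨n, hN⟩ (a ⟨n, hN⟩) (b ⟨n, hN⟩))
            (prod (p - 1) (nested P n (Nat.le_of_succ_le hN)) (nested Q n (Nat.le_of_succ_le hN))) +
          ∑ q ∈ Finset.Icc p (n : ℤ),
            prod (p - q) (P ⟨n, hN⟩)
              (prod 0 (Q ⟨n, hN⟩)
                (prod q (nested P n (Nat.le_of_succ_le hN))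
                  (nested Q n (Nat.le_of_succ_le hN))))) ∧
    (p = n + 1 →
      prod p (nested P (n + 1) hN) (nested Q (n + 1) hN) =
        prod 0 (S.R ⟨n, hN⟩ (a ⟨n, hN⟩) (b ⟨n, hN⟩))
          (prod (p - 1) (nested P n (Nat.le_of_succ_le hN))
            (nested Q n (Nat.le_of_succ_le hN)))) ∧
    ((n : ℤ) + 2 ≤ p →
      prod p (nested P (n + 1) hN) (nested Q (n + 1) hN) = 0) ∧
    (a ⟨n, hN⟩ = b ⟨n, hN⟩ →
      (p ≤ n →
        prod p (nested P (n + 1) hN) (nested Q (n + 1) hN) =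
          ∑ q ∈ Finset.Icc p (n : ℤ),
            prod (p - q) (P ⟨n, hN⟩)
              (prod 0 (Q ⟨n, hN⟩)
                (prod q (nested P n (Nat.le_of_succ_le hN))
                  (nested Q n (Nat.le_of_succ_le hN))))) ∧
      ((n : ℤ) + 1 ≤ p →
        prod p (nested P (n + 1) hN) (nested Q (n + 1) hN) = 0)) := by
  obtain ⟨hloc, hstep⟩ := S.nested_step a b hP hQ hn hN
    (S.isLocal_nested_nested a b hP hQ hn (Nat.le_of_succ_le hN))
  have hmain (h : p ≤ n + 1) : prod p (nested P (n + 1) hN) (nested Q (n + 1) hN) =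
      prod 0 (S.R ⟨n, hN⟩ (a ⟨n, hN⟩) (b ⟨n, hN⟩))
          (prod (p - 1) (nested P n (Nat.le_of_succ_le hN)) (nested Q n (Nat.le_of_succ_le hN))) +
        ∑ q ∈ Finset.Icc p (n : ℤ),
          prod (p - q) (P ⟨n, hN⟩)
            (prod 0 (Q ⟨n, hN⟩)
              (prod q (nested P n (Nat.le_of_succ_le hN))
                (nested Q n (Nat.le_of_succ_le hN)))) := by
    have := hstep (n + 1 - p).toNat
    rwa [Int.toNat_of_nonneg (by omega), show (n : ℤ) + 1 - (n + 1 - p) = p by ring,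
      show (n : ℤ) - (n + 1 - p) = p - 1 by ring] at this
  -- At `p = n + 1` the general formula still holds, with an empty sum.
  have hempty (h : p = n + 1) : Finset.Icc p (n : ℤ) = ∅ := Finset.Icc_eq_empty (by omega)
  have hzero (h : (n : ℤ) + 2 ≤ p) : prod p (nested P (n + 1) hN) (nested Q (n + 1) hN) = 0 :=
    hloc.prod_eq_zero (by push_cast; omega)
  refine ⟨fun h => hmain (by omega), fun h => ?_, hzero, fun hab => ⟨fun h => ?_, fun h => ?_⟩⟩
  · rw [hmain h.le, hempty h, Finset.sum_empty, add_zero]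
  · rw [hmain (by omega), hab, S.R_self, prod_zero_field, zero_add]
  · rcases h.eq_or_lt with h | h
    · rw [hmain h.ge, hempty h.symm, Finset.sum_empty, hab, S.R_self, prod_zero_field, add_zero]
    · exact hzero (by omega)
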